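/- For $n\ge 1$, a matrix from the Gaussian Unitary Ensemble (GUE) of size $n$ is a random Hermitian $n\times n$ matrix whose diagonal entries are real Gaussian variables of mean $0$ and variance $1$, and whose entries above the diagonal have real and imaginary parts that are Gaussian of mean $0$ and variance $1/2$, all these variables being independent. Let $t\in[0,1]$. For every $n\ge 1$ let $X_n$ and $Y_n$ be independent GUE matrices of size $n$, let $$A_{n,t}=\sqrt{\tfrac{1+t}{2}}\,X_n+i\sqrt{\tfrac{1-t}{2}}\,Y_n ,$$ and for $z$ in the open unit disk $\mathbb D=\{z\in\mathbb C:|z|<1\}$ let $$f_{n,t}(z)=\det\Big(1+tz^2-\frac{z}{\sqrt n}A_{n,t}\Big)\,e^{-ntz^2/2}.$$ Let $\mathcal H(\mathbb D)$ be the space of holomorphic functions on $\mathbb D$ with the topology of uniform convergence on compact subsets of $\mathbb D$ and its Borel $\sigma$-algebra. Then the $f_{n,t}$, $n\ge 1$, are random elements of $\mathcal H(\mathbb D)$, and the sequence $\{f_{n,t}\}_{n\ge1}$ is tight: for every $\varepsilon>0$ there is a compact set $K\subset\mathcal H(\mathbb D)$ such that $\mathbb P(f_{n,t}\notin K)\le\varepsilon$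 for every $n\ge 1$. -/

import Mathlib

open MeasureTheory ProbabilityTheory

noncomputable section

namespace EllipticGinibre

/-- The open unit disk. -/
abbrev disk : Set ℂ := Metric.ball (0 : ℂ) 1

/-- `H(𝔻)`: the functions `𝔻 → ℂ` that are holomorphic on the open unit disk. -/
def HolD : Type :=
  {f : C(disk, ℂ) // ∃ g : ℂ → ℂ, DifferentiableOn ℂ g disk ∧ ∀ z : disk, f z = g z}

/-- The topology of uniform convergence on compact subsets of the disk, which is the
compact-open topology. -/
instance : TopologicalSpace HolD :=
  inferInstanceAs (TopologicalSpace
    {f : C(disk, ℂ) // ∃ g : ℂ → ℂ, DifferentiableOn ℂ g disk ∧ ∀ z : disk, f z = g z})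

instance : MeasurableSpace HolD := borel HolD

instance : BorelSpace HolD := ⟨rfl⟩

/-- The element of `H(𝔻)` given by a function on `ℂ` that is holomorphic on the disk. -/
def HolD.ofDifferentiableOn (g : ℂ → ℂ) (hg : DifferentiableOn ℂ g disk) : HolD :=
  ⟨⟨fun z => g z, continuousOn_iff_continuous_domRestrict.1 hg.continuousOn⟩,
    g, hg, fun _ => rfl⟩

/-- Complex matrices carry the product σ-algebra of their entries. -/
instance (n : ℕ) : MeasurableSpace (Matrix (Fin n) (Fin n) ℂ) :=
  inferInstanceAs (MeasurableSpace (Fin n → Fin n → ℂ))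

/-- The Hermitian matrix with diagonal entries `g (i, i)` and with entries
`(g (i, j) + 𝐢 g (j, i)) / √2` above the diagonal. -/
def hermitianOf {n : ℕ} (g : Fin n × Fin n → ℝ) : Matrix (Fin n) (Fin n) ℂ :=
  Matrix.of fun i j =>
    if i = j then (g (i, i) : ℂ)
    else if i < j then ((g (i, j) : ℂ) + Complex.I * (g (j, i) : ℂ)) / (Real.sqrt 2 : ℂ)
    else ((g (j, i) : ℂ) - Complex.I * (g (i, j) : ℂ)) / (Real.sqrt 2 : ℂ)

/-- The law of the Gaussian Unitary Ensemble of size `n`: a Hermitian matrix whose diagonal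
entries are standard real Gaussians and whose entries above the diagonal have independent
centred Gaussian real and imaginary parts of variance `1/2`, all of these independent. -/
def gue (n : ℕ) : Measure (Matrix (Fin n) (Fin n) ℂ) :=
  (Measure.pi fun _ : Fin n × Fin n => gaussianReal 0 1).map hermitianOf

theorem measurable_hermitianOf (n : ℕ) : Measurable (hermitianOf (n := n)) := by
  refine measurable_pi_lambda _ fun i => measurable_pi_lambda _ fun j => ?_
  simp only [hermitianOf, Matrix.of_apply]
  split_ifs <;> fun_prop

instance (n : ℕ) : IsProbabilityMeasure (gue n) :=
  Measure.isProbabilityMeasure_map (measurable_hermitianOf n).aemeasurable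

/-- `A_{n,t} = √((1+t)/2) X + 𝐢 √((1-t)/2) Y`, which for independent `X`, `Y` with law `gue n`
is a matrix of the Elliptic Ginibre Ensemble. -/
def ellipticMatrix {n : ℕ} (t : ℝ) (X Y : Matrix (Fin n) (Fin n) ℂ) :
    Matrix (Fin n) (Fin n) ℂ :=
  (Real.sqrt ((1 + t) / 2) : ℂ) • X + (Complex.I * (Real.sqrt ((1 - t) / 2) : ℂ)) • Y

/-- `z ↦ det(1 + t z² - (z / √n) A) exp(- n t z² / 2)`. -/
def normCharFun {n : ℕ} (t : ℝ) (A : Matrix (Fin n) (Fin n) ℂ) (z : ℂ) : ℂ :=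
  Matrix.det ((1 + (t : ℂ) * z ^ 2) • (1 : Matrix (Fin n) (Fin n) ℂ)
      - (z / (Real.sqrt n : ℂ)) • A)
    * Complex.exp (-((n : ℂ) * (t : ℂ) * z ^ 2 / 2))

theorem differentiable_normCharFun {n : ℕ} (t : ℝ) (A : Matrix (Fin n) (Fin n) ℂ) :
    Differentiable ℂ (normCharFun t A) := by
  unfold normCharFun
  simp only [Matrix.det_apply, Matrix.sub_apply, Matrix.smul_apply, smul_eq_mul]
  fun_prop

/-- The normalised characteristic polynomial of `A`, as an element of `H(𝔻)`. -/
def normCharPoly {n : ℕ} (t : ℝ) (A : Matrix (Fin n) (Fin n) ℂ) : HolD :=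
  HolD.ofDifferentiableOn (normCharFun t A) (differentiable_normCharFun t A).differentiableOn

end EllipticGinibre

end

/-! Everything rests on one estimate: on each circle |z| = R with 0 < R < 1, E|f_n(z)|² is bounded
uniformly in n (`integral_norm_normCharFun_sq_le`). Cauchy's formula turns integral control on
circles into sup control on smaller disks; Markov's inequality and Montel's theorem
(`isCompact_boundedFamily`) then give tightness.

The second moment is computed exactly. Let ℓ be a linear functional on ℂ[X] and expand the
characteristic polynomial along row and column j. Its value under ℓ is a combination of 1, the entry
A_jj and the centred products A_ji A_kj. These are orthonormal in L² and independent of the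
coefficients, which depend only on the minor without j. With χ the characteristic polynomial of that
minor, the mean t of A_ji A_ij contributes -t times the trace of an adjugate, that is -tχ', so the
coefficient of 1 is ℓ(Xχ - tχ'): the raising operator of the Hermite polynomials H_k appears.
Pythagoras (`integral_norm_sq_sum_mul`) gives a recursion in n, which closes once the second moments
of the adjugate entries are carried along and ℓ is left arbitrary. It yields E|ℓ(charpoly)|² = Σ_{k
≤ n} (n!/k!) |ℓ(H_k)|² (`IsElliptic.integral_norm_sq`).

For ℓ the evaluation at √n(1 + tz²)/z, a Cauchy estimate for the Hermite generating function on the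
circle of radius √(k/n), combined with Stirling, bounds the normalised k-th term by a constant times
|z|^(2(n-k)) for k ≥ 1 (`hermite_term_le`). The sum is then dominated by a geometric series. -/

noncomputable section

namespace EllipticGinibre

open Polynomial

/-! ### Determinants and adjugates expanded along one row and column -/

section Bordered

variable {ι R : Type*} [Fintype ι] [DecidableEq ι] [CommRing R]

/-- The principal submatrix obtained by deleting the index `j`. -/
abbrev deleteIndex {R : Type*} (B : Matrix ι ι R) (j : ι) :
    Matrix {i // ¬ i = j} {i // ¬ i = j} R :=
  B.submatrix Subtype.val Subtype.val

theorem det_updateCol_single (B : Matrix ι ι R) (j : ι) (d : R) :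
    (B.updateCol j (Pi.single j d)).det = d * (deleteIndex B j).det := by
  rw [Matrix.twoBlockTriangular_det _ (fun i => i = j)]
  · congr 1
    · have : Subsingleton {i // i = j} := ⟨fun x y => Subtype.ext (x.2.trans y.2.symm)⟩
      have h := Matrix.det_eq_elem_of_subsingleton
        (Matrix.toSquareBlockProp (B.updateCol j (Pi.single j d)) fun i => i = j) ⟨j, rfl⟩
      convert h
      simp [Matrix.toSquareBlockProp]
    · congr 1
      ext i k
      simp [Matrix.toSquareBlockProp, k.2]
  · rintro i hi k rfl
    simp [hi]

/-- The vector which is mapped by `B` to a multiple of the `j`-th basis vector. -/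
def borderVec (B : Matrix ι ι R) (j : ι) (i : ι) : R :=
  if h : i = j then (deleteIndex B j).det
  else -∑ k : {i // ¬ i = j}, (deleteIndex B j).adjugate ⟨i, h⟩ k * B k j

/-- The determinant of `B`, expanded along row and column `j`. -/
def borderDet (B : Matrix ι ι R) (j : ι) : R :=
  B j j * (deleteIndex B j).det - ∑ i : {i // ¬ i = j}, ∑ k : {i // ¬ i = j},
    B j i * (deleteIndex B j).adjugate i k * B k j

theorem mulVec_borderVec (B : Matrix ι ι R) (j : ι) :
    B.mulVec (borderVec B j) = Pi.single j (borderDet B j) := by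
  ext i
  rw [Matrix.mulVec, dotProduct, Fintype.sum_eq_add_sum_subtype_ne _ j]
  have h1 : ∀ k : {i // ¬ i = j}, borderVec B j k =
      -∑ l : {i // ¬ i = j}, (deleteIndex B j).adjugate k l * B l j := fun k => by
    rw [borderVec, dif_neg k.2]
  have h0 : borderVec B j j = (deleteIndex B j).det := by simp [borderVec]
  simp only [h1, h0]
  by_cases hi : i = j
  · subst hi
    simp only [Pi.single_eq_same, borderDet, mul_neg, Finset.sum_neg_distrib, Finset.mul_sum,
      ← mul_assoc, sub_eq_add_neg]
  · rw [Pi.single_eq_of_ne hi]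
    have h2 : ∀ l : {i // ¬ i = j}, ∑ k : {i // ¬ i = j}, B i k * (deleteIndex B j).adjugate k l
        = if (⟨i, hi⟩ : {i // ¬ i = j}) = l then (deleteIndex B j).det else 0 := fun l => by
      have := congrFun (congrFun (Matrix.mul_adjugate (deleteIndex B j)) ⟨i, hi⟩) l
      rw [Matrix.mul_apply] at this
      simpa [Matrix.one_apply] using this
    simp only [mul_neg, Finset.sum_neg_distrib, Finset.mul_sum, ← mul_assoc]
    rw [Finset.sum_comm]
    simp only [← Finset.sum_mul, h2]
    simp [mul_comm]

/-- Replace column j of the identity by `borderVec` and multiply by B: the product is B with column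
j replaced by a multiple of the basis vector e_j. Taking determinants leaves a common factor, the
minor, which can be cancelled in a domain. -/
theorem det_eq_borderDet [IsDomain R] (B : Matrix ι ι R) (j : ι)
    (h : (deleteIndex B j).det ≠ 0) : B.det = borderDet B j := by
  have h1 : B * (1 : Matrix ι ι R).updateCol j (borderVec B j) =
      B.updateCol j (Pi.single j (borderDet B j)) := by
    rw [← mulVec_borderVec, Matrix.mul_updateCol, mul_one]
  have h2 := congrArg Matrix.det h1
  rw [Matrix.det_mul, det_updateCol_single] at h2
  have h3 : ((1 : Matrix ι ι R).updateCol j (borderVec B j)).det = (deleteIndex B j).det := by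
    rw [← Matrix.cramer_apply, Matrix.cramer_one]
    simp [borderVec]
  rw [h3] at h2
  exact mul_right_cancel₀ h h2

/-- Apply the adjugate to the identity `mulVec_borderVec`; both sides carry the factor det B, which
is cancelled. -/
theorem adjugate_eq_borderVec [IsDomain R] (B : Matrix ι ι R) (j i : ι) (hB : B.det ≠ 0)
    (h : (deleteIndex B j).det ≠ 0) : B.adjugate i j = borderVec B j i := by
  have h1 := congrArg (B.adjugate.mulVec) (mulVec_borderVec B j)
  rw [Matrix.mulVec_mulVec, Matrix.adjugate_mul, ← det_eq_borderDet B j h] at h1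
  have h2 := congrFun h1 i
  simp only [Matrix.smul_mulVec, Matrix.one_mulVec, Pi.smul_apply, smul_eq_mul,
    Matrix.mulVec_single, MulOpposite.smul_eq_mul_unop] at h2
  simp [mul_comm] at h2
  grind

theorem derivative_det (M : Matrix ι ι R[X]) :
    derivative M.det = ∑ i, (M.updateRow i fun k => derivative (M i k)).det := by
  have h : ∀ N : Matrix ι ι R[X],
      N.det = ∑ σ : Equiv.Perm ι, C ((Equiv.Perm.sign σ : ℤ) : R) * ∏ i, N i (σ i) := fun N => by
    rw [← Matrix.det_transpose, Matrix.det_apply']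
    simp
  simp only [h, derivative_sum, derivative_C_mul, derivative_prod_finset]
  rw [Finset.sum_comm]
  refine Finset.sum_congr rfl fun σ _ => ?_
  rw [Finset.mul_sum]
  refine Finset.sum_congr rfl fun i _ => ?_
  congr 1
  rw [← Finset.prod_erase_mul _ _ (Finset.mem_univ i)]
  congr 1
  · refine Finset.prod_congr rfl fun k hk => ?_
    rw [Matrix.updateRow_ne (Finset.ne_of_mem_erase hk)]
  · simp

end Bordered

/-! ### Characteristic matrices: the minors are monic, so the expansions apply -/

section Charpoly

variable {ι : Type*} [Fintype ι] [DecidableEq ι]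

theorem deleteIndex_charmatrix (A : Matrix ι ι ℂ) (j : ι) :
    deleteIndex A.charmatrix j = (deleteIndex A j).charmatrix := by
  ext i k
  simp [Matrix.charmatrix_apply, Matrix.diagonal_apply, Subtype.ext_iff]

/-- Differentiating row i of X - A leaves the basis vector e_i, and the determinant with that row is
a diagonal cofactor. -/
theorem derivative_charpoly (A : Matrix ι ι ℂ) :
    derivative A.charpoly = ∑ i, A.charmatrix.adjugate i i := by
  rw [Matrix.charpoly, derivative_det]
  refine Finset.sum_congr rfl fun i _ => ?_
  rw [Matrix.adjugate_apply]
  congr 2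
  ext k
  by_cases h : i = k
  · subst h; simp
  · simp [h, Ne.symm h]

theorem charpoly_eq_deleteIndex (A : Matrix ι ι ℂ) (j : ι) :
    A.charpoly = (X - C (A j j)) * (deleteIndex A j).charpoly -
      ∑ i : {i // ¬ i = j}, ∑ k : {i // ¬ i = j},
        C (A j i * A k j) * (deleteIndex A j).charmatrix.adjugate i k := by
  have h : (deleteIndex A.charmatrix j).det ≠ 0 := by
    rw [deleteIndex_charmatrix]
    exact (Matrix.charpoly_monic _).ne_zero
  have hs : ∀ i k : {i // ¬ i = j},
      A.charmatrix j i * (deleteIndex A j).charmatrix.adjugate i k * A.charmatrix k j =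
        C (A j i * A k j) * (deleteIndex A j).charmatrix.adjugate i k := fun i k => by
    rw [Matrix.charmatrix_apply_ne _ _ _ (Ne.symm i.2), Matrix.charmatrix_apply_ne _ _ _ k.2, C_mul]
    ring
  have h1 := det_eq_borderDet A.charmatrix j h
  rw [borderDet, deleteIndex_charmatrix, Matrix.charmatrix_apply_eq] at h1
  simp only [hs] at h1
  exact h1

theorem adjugate_charmatrix_same (A : Matrix ι ι ℂ) (j : ι) :
    A.charmatrix.adjugate j j = (deleteIndex A j).charpoly := by
  have h : (deleteIndex A.charmatrix j).det ≠ 0 := by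
    rw [deleteIndex_charmatrix]
    exact (Matrix.charpoly_monic _).ne_zero
  rw [adjugate_eq_borderVec _ j j (Matrix.charpoly_monic A).ne_zero h]
  simp [borderVec, deleteIndex_charmatrix, Matrix.charpoly]

theorem adjugate_charmatrix_ne (A : Matrix ι ι ℂ) (j : ι) (i : {i // ¬ i = j}) :
    A.charmatrix.adjugate i j =
      ∑ k : {i // ¬ i = j}, C (A k j) * (deleteIndex A j).charmatrix.adjugate i k := by
  have h : (deleteIndex A.charmatrix j).det ≠ 0 := by
    rw [deleteIndex_charmatrix]
    exact (Matrix.charpoly_monic _).ne_zero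
  rw [adjugate_eq_borderVec _ j i (Matrix.charpoly_monic A).ne_zero h, borderVec, dif_neg i.2,
    deleteIndex_charmatrix, ← Finset.sum_neg_distrib]
  refine Finset.sum_congr rfl fun k _ => ?_
  rw [Matrix.charmatrix_apply_ne _ _ _ k.2]
  ring

end Charpoly

end EllipticGinibre

end

noncomputable section

namespace EllipticGinibre

open Polynomial
open scoped ComplexConjugate

/-! ### Pythagoras with independent random coefficients -/

section Independence

variable {Ω : Type*} {mΩ : MeasurableSpace Ω} {P : Measure Ω}

theorem indepFun_of_indep {m₁ m₂ : MeasurableSpace Ω} (h : Indep m₁ m₂ P) {β γ : Type*}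
    [MeasurableSpace β] [MeasurableSpace γ] {f : Ω → β} {g : Ω → γ}
    (hf : Measurable[m₁] f) (hg : Measurable[m₂] g) : IndepFun f g P := by
  rw [IndepFun_iff_Indep]
  exact indep_of_indep_of_le_left (indep_of_indep_of_le_right h hg.comap_le) hf.comap_le

theorem measurable_conj {m : MeasurableSpace Ω} {f : Ω → ℂ} (hf : Measurable[m] f) :
    Measurable[m] fun ω => conj (f ω) :=
  Complex.continuous_conj.measurable.comp hf

theorem measurable_mul_fun {m : MeasurableSpace Ω} {f g : Ω → ℂ} (hf : Measurable[m] f)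
    (hg : Measurable[m] g) : Measurable[m] fun ω => f ω * g ω :=
  hf.mul hg

theorem memLp_conj {f : Ω → ℂ} {p : ENNReal} (hf : MemLp f p P) :
    MemLp (fun ω => conj (f ω)) p P :=
  hf.of_le (Complex.continuous_conj.comp_aestronglyMeasurable hf.1) (by simp)

theorem integrable_mul_conj {f g : Ω → ℂ} (hf : MemLp f 2 P) (hg : MemLp g 2 P) :
    Integrable (fun ω => f ω * conj (g ω)) P :=
  hf.integrable_mul (memLp_conj hg)

theorem memLp_two_mul_of_memLp_four {f g : Ω → ℂ} (hf : MemLp f 4 P) (hg : MemLp g 4 P) :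
    MemLp (fun ω => f ω * g ω) 2 P := by
  have : ENNReal.HolderTriple 4 4 2 := ⟨by
    have h : (4 : ENNReal) = 2 * 2 := by norm_num
    rw [h, ENNReal.mul_inv (by simp) (by simp), ← mul_add, ENNReal.inv_two_add_inv_two, mul_one]⟩
  exact hg.mul hf

/-- If the `W a` are orthonormal in `L²` and independent of the coefficients `K a`, then
`‖∑ K a W a‖² = ∑ ‖K a‖²`. -/
theorem integral_norm_sq_sum_mul {Ω : Type*} {m₁ m₂ mΩ : MeasurableSpace Ω} {P : Measure Ω}
    [IsProbabilityMeasure P] (h₁ : m₁ ≤ mΩ) (h₂ : m₂ ≤ mΩ) (hind : Indep m₁ m₂ P)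
    {J : Type*} [Fintype J] [DecidableEq J] {K W : J → Ω → ℂ}
    (hKm : ∀ a, Measurable[m₁] (K a)) (hWm : ∀ a, Measurable[m₂] (W a))
    (hK : ∀ a, MemLp (K a) 2 P) (hW : ∀ a, MemLp (W a) 2 P)
    (horth : ∀ a b, ∫ ω, W a ω * conj (W b ω) ∂P = if a = b then 1 else 0) :
    MemLp (fun ω => ∑ a, K a ω * W a ω) 2 P ∧
      ∫ ω, ‖∑ a, K a ω * W a ω‖ ^ 2 ∂P = ∑ a, ∫ ω, ‖K a ω‖ ^ 2 ∂P := by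
  have hi : ∀ a b, IndepFun (fun ω => K a ω * conj (K b ω)) (fun ω => W a ω * conj (W b ω)) P :=
    fun a b => indepFun_of_indep hind (measurable_mul_fun (hKm a) (measurable_conj (hKm b)))
      (measurable_mul_fun (hWm a) (measurable_conj (hWm b)))
  have hI : ∀ a b, Integrable
      (fun ω => (K a ω * conj (K b ω)) * (W a ω * conj (W b ω))) P := fun a b =>
    (hi a b).integrable_mul (integrable_mul_conj (hK a) (hK b)) (integrable_mul_conj (hW a) (hW b))
  constructor
  · refine memLp_finsetSum _ fun a _ => ?_
    have hm : AEStronglyMeasurable (fun ω => K a ω * W a ω) P :=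
      (measurable_mul_fun ((hKm a).mono h₁ le_rfl) ((hWm a).mono h₂ le_rfl)).aestronglyMeasurable
    rw [memLp_two_iff_integrable_sq_norm hm]
    refine (hI a a).norm.congr (ae_of_all _ fun ω => ?_)
    simp only [norm_mul, RCLike.norm_conj]
    ring
  · apply Complex.ofReal_injective
    rw [← integral_complex_ofReal]
    have e : ∀ ω, ((‖∑ a, K a ω * W a ω‖ ^ 2 : ℝ) : ℂ) =
        ∑ a, ∑ b, (K a ω * conj (K b ω)) * (W a ω * conj (W b ω)) := fun ω => by
      rw [Complex.ofReal_pow, ← Complex.mul_conj', map_sum, Finset.sum_mul_sum]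
      refine Finset.sum_congr rfl fun a _ => Finset.sum_congr rfl fun b _ => ?_
      rw [map_mul]
      ring
    simp only [e]
    rw [integral_finsetSum _ fun a _ => integrable_finsetSum _ fun b _ => hI a b,
      Complex.ofReal_sum]
    refine Finset.sum_congr rfl fun a _ => ?_
    rw [integral_finsetSum _ fun b _ => hI a b, Finset.sum_eq_single a]
    · rw [(hi a a).integral_fun_mul_eq_mul_integral (integrable_mul_conj (hK a) (hK a)).1
        (integrable_mul_conj (hW a) (hW a)).1, horth, if_pos rfl, mul_one,
        ← integral_complex_ofReal]
      simp only [Complex.mul_conj', Complex.ofReal_pow]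
    · intro b _ hb
      rw [(hi a b).integral_fun_mul_eq_mul_integral (integrable_mul_conj (hK a) (hK b)).1
        (integrable_mul_conj (hW a) (hW b)).1, horth, if_neg (Ne.symm hb), mul_zero]
    · simp

end Independence

/-! ### Orthonormality of the centred products of row and column entries -/

section Border

variable {Ω : Type*} {mΩ : MeasurableSpace Ω} {P : Measure Ω} {κ : Type*}

/-- The row and the column of an elliptic matrix through a diagonal position: independent pairs
`(r i, c i)`, where `F S` contains the information on the pairs with index in `S`. -/
structure IsEllipticBorder (t : ℝ) (r c : κ → Ω → ℂ) (F : Set κ → MeasurableSpace Ω)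
    (P : Measure Ω) : Prop where
  le : ∀ S, F S ≤ mΩ
  indep : ∀ S T, Disjoint S T → Indep (F S) (F T) P
  measurable_row : ∀ {S i}, i ∈ S → Measurable[F S] (r i)
  measurable_col : ∀ {S i}, i ∈ S → Measurable[F S] (c i)
  memLp_row : ∀ i, MemLp (r i) 4 P
  memLp_col : ∀ i, MemLp (c i) 4 P
  mean_row : ∀ i, ∫ ω, r i ω ∂P = 0
  mean_col : ∀ i, ∫ ω, c i ω ∂P = 0
  sq_row : ∀ i, ∫ ω, r i ω * conj (r i ω) ∂P = 1
  sq_col : ∀ i, ∫ ω, c i ω * conj (c i ω) ∂P = 1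
  cross_conj : ∀ i, ∫ ω, r i ω * conj (c i ω) ∂P = 0
  cross : ∀ i, ∫ ω, r i ω * c i ω ∂P = t
  fourth : ∀ i, ∫ ω, (r i ω * c i ω) * conj (r i ω * c i ω) ∂P = 1 + t ^ 2

namespace IsEllipticBorder

variable {t : ℝ} {r c : κ → Ω → ℂ} {F : Set κ → MeasurableSpace Ω}

theorem integral_mul_of_disjoint (h : IsEllipticBorder t r c F P) {S T : Set κ}
    (hST : Disjoint S T) {f g : Ω → ℂ} (hf : Measurable[F S] f) (hg : Measurable[F T] g) :
    ∫ ω, f ω * g ω ∂P = (∫ ω, f ω ∂P) * ∫ ω, g ω ∂P :=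
  (indepFun_of_indep (h.indep _ _ hST) hf hg).integral_fun_mul_eq_mul_integral
    (hf.mono (h.le S) le_rfl).aestronglyMeasurable (hg.mono (h.le T) le_rfl).aestronglyMeasurable

end IsEllipticBorder

variable {t : ℝ} {r c : κ → Ω → ℂ} {F : Set κ → MeasurableSpace Ω}

/-- The centred products of the entries of the row with those of the column. -/
def wickProd [DecidableEq κ] (t : ℝ) (r c : κ → Ω → ℂ) (i k : κ) (ω : Ω) : ℂ :=
  r i ω * c k ω - if i = k then (t : ℂ) else 0

namespace IsEllipticBorder

variable [DecidableEq κ]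

theorem measurable_wickProd (h : IsEllipticBorder t r c F P) {i k : κ} {S : Set κ}
    (hi : i ∈ S) (hk : k ∈ S) : Measurable[F S] (wickProd t r c i k) :=
  (measurable_mul_fun (h.measurable_row hi) (h.measurable_col hk)).sub_const _

variable [IsProbabilityMeasure P]

theorem memLp_wickProd (h : IsEllipticBorder t r c F P) (i k : κ) :
    MemLp (wickProd t r c i k) 2 P :=
  (memLp_two_mul_of_memLp_four (h.memLp_row _) (h.memLp_col _)).sub (memLp_const _)

theorem integral_wickProd (h : IsEllipticBorder t r c F P) {i k : κ} :
    ∫ ω, wickProd t r c i k ω ∂P = 0 := by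
  have hI : Integrable (fun ω => r i ω * c k ω) P :=
    (memLp_two_mul_of_memLp_four (h.memLp_row _) (h.memLp_col _)).integrable (by norm_num)
  simp only [wickProd]
  rw [integral_sub hI (integrable_const _), integral_const]
  by_cases hik : i = k
  · subst hik
    simp [h.cross i]
  · rw [h.integral_mul_of_disjoint (S := {i}) (T := {k}) (by simpa using hik)
      (h.measurable_row rfl) (h.measurable_col rfl)]
    simp [h.mean_row, hik]

/-- Expectations factor over distinct indices, and an index met only once kills the term because the
entries are centred. For i ≠ k the matching i = i', k = k' gives 1, while the crossed matching i =
k', k = i' contains E(r conj c) = 0. For i = k the variance is (1 + t²) - t² = 1. -/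
theorem integral_wickProd_mul_conj (h : IsEllipticBorder t r c F P)
    {i k i' k' : κ} :
    ∫ ω, wickProd t r c i k ω * conj (wickProd t r c i' k' ω) ∂P =
      if i = i' ∧ k = k' then 1 else 0 := by
  have er : ∀ i, ∫ ω, conj (r i ω) ∂P = 0 := fun i => by
    rw [integral_conj, h.mean_row, map_zero]
  have ec : ∀ i, ∫ ω, conj (c i ω) ∂P = 0 := fun i => by
    rw [integral_conj, h.mean_col, map_zero]
  have mr : ∀ {S : Set κ} {i : κ}, i ∈ S → Measurable[F S] (r i) := h.measurable_row
  have ml : ∀ {S : Set κ} {i : κ}, i ∈ S → Measurable[F S] (c i) := h.measurable_col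
  -- If i' = i then k' differs from both and its column entry stands alone; otherwise the row entry
  -- at i' stands alone. Either factor has mean zero.
  have diag : ∀ i i' k', i' ≠ k' →
      ∫ ω, wickProd t r c i i ω * conj (wickProd t r c i' k' ω) ∂P = 0 := by
    intro i i' k' hne
    have e0 : ∀ ω, wickProd t r c i' k' ω = r i' ω * c k' ω := fun ω => by simp [wickProd, hne]
    simp only [e0]
    by_cases h1 : i' = i
    · have e : ∀ ω, wickProd t r c i i ω * conj (r i' ω * c k' ω) =
          (wickProd t r c i i ω * conj (r i' ω)) * conj (c k' ω) := fun ω => by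
        rw [map_mul]; ring
      simp only [e]
      rw [h.integral_mul_of_disjoint (S := {i, i'}) (T := {k'}) (by grind [Set.disjoint_right])
        (measurable_mul_fun (h.measurable_wickProd (by simp) (by simp))
          (measurable_conj (mr (by simp))))
        (measurable_conj (ml rfl)), ec, mul_zero]
    · have e : ∀ ω, wickProd t r c i i ω * conj (r i' ω * c k' ω) =
          (wickProd t r c i i ω * conj (c k' ω)) * conj (r i' ω) := fun ω => by
        rw [map_mul]; ring
      simp only [e]
      rw [h.integral_mul_of_disjoint (S := {i, k'}) (T := {i'}) (by grind [Set.disjoint_right])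
        (measurable_mul_fun (h.measurable_wickProd (by simp) (by simp))
          (measurable_conj (ml (by simp))))
        (measurable_conj (mr rfl)), er, mul_zero]
  by_cases hik : i = k
  · subst hik
    by_cases hik' : i' = k'
    · subst hik'
      by_cases hii : i = i'
      · subst hii
        have hI : Integrable (fun ω => r i ω * c i ω) P :=
          (memLp_two_mul_of_memLp_four (h.memLp_row _) (h.memLp_col _)).integrable (by norm_num)
        have hI4 : Integrable (fun ω => (r i ω * c i ω) * conj (r i ω * c i ω)) P :=
          integrable_mul_conj (memLp_two_mul_of_memLp_four (h.memLp_row _) (h.memLp_col _))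
            (memLp_two_mul_of_memLp_four (h.memLp_row _) (h.memLp_col _))
        -- One conjugate is left in centred form, so that its term integrates to zero.
        have e : ∀ ω, wickProd t r c i i ω * conj (wickProd t r c i i ω) =
            (r i ω * c i ω) * conj (r i ω * c i ω) -
              t * conj (wickProd t r c i i ω) - t * (r i ω * c i ω) := fun ω => by
          simp only [wickProd, if_true, map_sub, Complex.conj_ofReal]
          ring
        have hwc : Integrable (fun ω => conj (wickProd t r c i i ω)) P :=
          (memLp_conj (h.memLp_wickProd i i)).integrable (by norm_num)
        have hsub : Integrable (fun ω => (r i ω * c i ω) * conj (r i ω * c i ω) -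
            t * conj (wickProd t r c i i ω)) P := hI4.sub (hwc.const_mul _)
        simp only [e]
        rw [integral_sub hsub (hI.const_mul _),
          integral_sub hI4 (hwc.const_mul _), integral_const_mul, integral_const_mul,
          h.fourth i, h.cross i, integral_conj, h.integral_wickProd]
        simp
        ring
      · rw [h.integral_mul_of_disjoint (S := {i}) (T := {i'}) (by simpa using hii)
          (h.measurable_wickProd rfl rfl) (measurable_conj (h.measurable_wickProd rfl rfl)),
          h.integral_wickProd, zero_mul, if_neg (by tauto)]
    · rw [diag i i' k' hik', if_neg (by grind)]
  · by_cases hik' : i' = k'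
    · subst hik'
      rw [if_neg (by grind), ← map_zero (starRingEnd ℂ), ← diag i' i k hik,
        ← integral_conj]
      simp [mul_comm]
    · simp only [wickProd, if_neg hik, if_neg hik', sub_zero]
      by_cases h1 : i = i' ∨ i = k'
      · by_cases h2 : k = i' ∨ k = k'
        · rcases h1 with h1 | h1
          · have h2' : k = k' := by grind
            subst h1 h2'
            have e : ∀ ω, r i ω * c k ω * conj (r i ω * c k ω) =
                (r i ω * conj (r i ω)) * (c k ω * conj (c k ω)) := fun ω => by
              rw [map_mul]; ring
            simp only [e]
            rw [h.integral_mul_of_disjoint (S := {i}) (T := {k}) (by simpa using hik)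
              (measurable_mul_fun (mr rfl) (measurable_conj (mr rfl)))
              (measurable_mul_fun (ml rfl) (measurable_conj (ml rfl))),
              h.sq_row, h.sq_col]
            simp
          · have h2' : k = i' := by grind
            subst h1 h2'
            have e : ∀ ω, r i ω * c k ω * conj (r k ω * c i ω) =
                (r i ω * conj (c i ω)) * (c k ω * conj (r k ω)) := fun ω => by
              rw [map_mul]; ring
            simp only [e]
            rw [h.integral_mul_of_disjoint (S := {i}) (T := {k}) (by simpa using hik)
              (measurable_mul_fun (mr rfl) (measurable_conj (ml rfl)))
              (measurable_mul_fun (ml rfl) (measurable_conj (mr rfl))),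
              h.cross_conj i, zero_mul, if_neg (by grind)]
        · have e : ∀ ω, r i ω * c k ω * conj (r i' ω * c k' ω) =
              (r i ω * conj (r i' ω * c k' ω)) * c k ω := fun ω => by ring
          simp only [e]
          rw [h.integral_mul_of_disjoint (S := {i, i', k'}) (T := {k})
            (by grind [Set.disjoint_right])
            (measurable_mul_fun (mr (by simp))
            (measurable_conj (measurable_mul_fun (mr (by simp)) (ml (by simp))))) (ml rfl),
            h.mean_col, mul_zero, if_neg (by grind)]
      · have e : ∀ ω, r i ω * c k ω * conj (r i' ω * c k' ω) =
            (c k ω * conj (r i' ω * c k' ω)) * r i ω := fun ω => by ring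
        simp only [e]
        rw [h.integral_mul_of_disjoint (S := {k, i', k'}) (T := {i})
          (by grind [Set.disjoint_right])
          (measurable_mul_fun (ml (by simp))
            (measurable_conj (measurable_mul_fun (mr (by simp)) (ml (by simp))))) (mr rfl),
          h.mean_row, mul_zero, if_neg (by grind)]

end IsEllipticBorder

end Border

/-! ### Moment and independence axioms of an elliptic matrix -/

section Elliptic

variable {Ω : Type*} {mΩ : MeasurableSpace Ω} {P : Measure Ω} {ι : Type*}

/-- The σ-algebra generated by the entries `A i j` with `s(i, j) ∈ S`. -/
abbrev blockSigma (A : Ω → Matrix ι ι ℂ) (S : Set (Sym2 ι)) : MeasurableSpace Ω :=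
  ⨆ p : ι × ι, ⨆ _ : s(p.1, p.2) ∈ S, MeasurableSpace.comap (fun ω => A ω p.1 p.2) inferInstance

theorem measurable_blockSigma (A : Ω → Matrix ι ι ℂ) {S : Set (Sym2 ι)} {i j : ι}
    (h : s(i, j) ∈ S) : Measurable[blockSigma A S] fun ω => A ω i j := by
  rw [measurable_iff_comap_le]
  exact le_iSup₂_of_le (f := fun (p : ι × ι) (_ : s(p.1, p.2) ∈ S) =>
    MeasurableSpace.comap (fun ω => A ω p.1 p.2) inferInstance) (i, j) h le_rfl

theorem blockSigma_le {A : Ω → Matrix ι ι ℂ} {S : Set (Sym2 ι)} {m : MeasurableSpace Ω}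
    (h : ∀ i j, s(i, j) ∈ S → Measurable[m] fun ω => A ω i j) : blockSigma A S ≤ m :=
  iSup₂_le fun p hp => (h p.1 p.2 hp).comap_le

/-- A random matrix whose blocks `(A i j, A j i)` are independent and whose entries have the
moments up to order four of the elliptic ensemble of parameter `t`. -/
structure IsElliptic (t : ℝ) (A : Ω → Matrix ι ι ℂ) (P : Measure Ω) : Prop where
  measurable : ∀ i j, Measurable fun ω => A ω i j
  indep : ∀ S T : Set (Sym2 ι), Disjoint S T → Indep (blockSigma A S) (blockSigma A T) P
  memLp : ∀ i j, MemLp (fun ω => A ω i j) 4 P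
  mean : ∀ i j, ∫ ω, A ω i j ∂P = 0
  sq : ∀ i j, ∫ ω, A ω i j * conj (A ω i j) ∂P = 1
  cross_conj : ∀ i j, i ≠ j → ∫ ω, A ω i j * conj (A ω j i) ∂P = 0
  cross : ∀ i j, i ≠ j → ∫ ω, A ω i j * A ω j i ∂P = t
  fourth : ∀ i j, i ≠ j → ∫ ω, (A ω i j * A ω j i) * conj (A ω i j * A ω j i) ∂P = 1 + t ^ 2

/-- The class is stable under passing to minors, which is what lets the induction on the size run.
-/
theorem IsElliptic.submatrix {t : ℝ} {A : Ω → Matrix ι ι ℂ} (h : IsElliptic t A P)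
    {κ : Type*} {e : κ → ι} (he : Function.Injective e) :
    IsElliptic t (fun ω => (A ω).submatrix e e) P where
  measurable i j := h.measurable _ _
  indep S T hST := by
    have hle : ∀ S : Set (Sym2 κ), blockSigma (fun ω => (A ω).submatrix e e) S ≤
        blockSigma A (Sym2.map e '' S) := fun S => blockSigma_le fun i j hij =>
      measurable_blockSigma A ⟨s(i, j), hij, by simp⟩
    exact indep_of_indep_of_le_left (indep_of_indep_of_le_right
      (h.indep _ _ (Set.disjoint_image_of_injective (Sym2.map.injective he) hST)) (hle T)) (hle S)
  memLp i j := h.memLp _ _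
  mean i j := h.mean _ _
  sq i j := h.sq _ _
  cross_conj i j hij := h.cross_conj _ _ (he.ne hij)
  cross i j hij := h.cross _ _ (he.ne hij)
  fourth i j hij := h.fourth _ _ (he.ne hij)

end Elliptic

end EllipticGinibre

end

noncomputable section

namespace EllipticGinibre

open Polynomial
open scoped ComplexConjugate Nat

/-- The operator `q ↦ X q - t q'`, which raises the index of the Hermite polynomials. -/
def raiseOp (t : ℝ) : ℂ[X] →ₗ[ℂ] ℂ[X] := LinearMap.mulLeft ℂ X - (t : ℂ) • derivative

theorem raiseOp_apply (t : ℝ) (q : ℂ[X]) : raiseOp t q = X * q - C (t : ℂ) * derivative q := by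
  simp [raiseOp, smul_eq_C_mul]

/-- The monic Hermite polynomials of variance `t`. -/
def hermitePoly (t : ℝ) : ℕ → ℂ[X]
  | 0 => 1
  | k + 1 => raiseOp t (hermitePoly t k)

theorem map_C_mul (ℓ : ℂ[X] →ₗ[ℂ] ℂ) (a : ℂ) (q : ℂ[X]) : ℓ (C a * q) = a * ℓ q := by
  rw [C_mul', map_smul, smul_eq_mul]

/-! ### Linear functionals of the characteristic polynomial and of the adjugate -/

section Recursion

variable {ι : Type*} [Fintype ι] [DecidableEq ι]

theorem map_charpoly_eq (ℓ : ℂ[X] →ₗ[ℂ] ℂ) (A : Matrix ι ι ℂ) (j : ι) :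
    ℓ A.charpoly = ℓ (X * (deleteIndex A j).charpoly) - A j j * ℓ (deleteIndex A j).charpoly -
      ∑ i : {i // ¬ i = j}, ∑ k : {i // ¬ i = j},
        A j i * A k j * ℓ ((deleteIndex A j).charmatrix.adjugate i k) := by
  rw [charpoly_eq_deleteIndex A j, sub_mul, map_sub, map_sub, map_C_mul, map_sum]
  congr 1
  refine Finset.sum_congr rfl fun i _ => ?_
  rw [map_sum]
  exact Finset.sum_congr rfl fun k _ => map_C_mul _ _ _

theorem map_adjugate_ne (ℓ : ℂ[X] →ₗ[ℂ] ℂ) (A : Matrix ι ι ℂ) (j : ι) (i : {i // ¬ i = j}) :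
    ℓ (A.charmatrix.adjugate i j) = ∑ k : {i // ¬ i = j},
      ℓ ((deleteIndex A j).charmatrix.adjugate i k) * A k j := by
  rw [adjugate_charmatrix_ne, map_sum]
  exact Finset.sum_congr rfl fun k _ => by rw [map_C_mul, mul_comm]

/-- The σ-algebra is arbitrary so that it can be taken to be generated by the entries off row and
column j. This makes the coefficients of the expansion independent of the border. -/
theorem measurable_map_charpoly_and_adjugate {Ω : Type*} {m : MeasurableSpace Ω} (n : ℕ) :
    ∀ (ι : Type*) [Fintype ι] [DecidableEq ι], Fintype.card ι = n → ∀ A : Ω → Matrix ι ι ℂ,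
      (∀ i j, Measurable fun ω => A ω i j) → ∀ ℓ : ℂ[X] →ₗ[ℂ] ℂ,
      (Measurable fun ω => ℓ (A ω).charpoly) ∧
        ∀ i j, Measurable fun ω => ℓ ((A ω).charmatrix.adjugate i j) := by
  induction n with
  | zero =>
    intro ι _ _ hc A hA ℓ
    have : IsEmpty ι := Fintype.card_eq_zero_iff.1 hc
    refine ⟨?_, fun i => isEmptyElim i⟩
    simp [Matrix.charpoly]
  | succ n ih =>
    intro ι _ _ hc A hA ℓ
    have hc' : ∀ j : ι, Fintype.card {i // ¬ i = j} = n := fun j => by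
      simp [Fintype.card_subtype_compl, hc]
    have ih' := fun j => ih {i // ¬ i = j} (hc' j) (fun ω => deleteIndex (A ω) j)
      (fun i k => hA i k)
    constructor
    · obtain ⟨j⟩ : Nonempty ι := Fintype.card_pos_iff.1 (by omega)
      simp only [map_charpoly_eq ℓ _ j]
      refine Measurable.sub (((ih' j (ℓ ∘ₗ LinearMap.mulLeft ℂ X)).1).sub
        ((hA j j).mul (ih' j ℓ).1)) ?_
      exact Finset.measurable_fun_sum _ fun i _ => Finset.measurable_fun_sum _ fun k _ =>
        ((hA _ _).mul (hA _ _)).mul ((ih' j ℓ).2 i k)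
    · intro i j
      by_cases hij : i = j
      · subst hij
        simp only [adjugate_charmatrix_same]
        exact (ih' i ℓ).1
      · simp only [fun ω => map_adjugate_ne ℓ (A ω) j ⟨i, hij⟩]
        exact Finset.measurable_fun_sum _ fun k _ => ((ih' j ℓ).2 _ k).mul (hA _ _)

end Recursion

/-! ### Exact second moments by induction on the size -/

section Moments

variable {Ω : Type*} {mΩ : MeasurableSpace Ω} {P : Measure Ω}
  {ι : Type*} {t : ℝ} {A : Ω → Matrix ι ι ℂ}

/-- The sets of positions in row and column `j`. -/
abbrev starBlocks (j : ι) (S : Set {i // ¬ i = j}) : Set (Sym2 ι) :=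
  (fun i : {i // ¬ i = j} => s(j, (i : ι))) '' S

theorem IsElliptic.border (h : IsElliptic t A P) (j : ι) :
    IsEllipticBorder t (fun (i : {i // ¬ i = j}) ω => A ω j i) (fun i ω => A ω i j)
      (fun S => blockSigma A (starBlocks j S)) P where
  le _ := blockSigma_le fun i k _ => h.measurable i k
  indep _ _ hST := h.indep _ _ (Set.disjoint_image_of_injective
    (fun _ _ hab => Subtype.ext (Sym2.congr_right.1 hab)) hST)
  measurable_row hi := measurable_blockSigma A ⟨_, hi, rfl⟩
  measurable_col hi := measurable_blockSigma A ⟨_, hi, Sym2.eq_swap⟩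
  memLp_row _ := h.memLp _ _
  memLp_col _ := h.memLp _ _
  mean_row _ := h.mean _ _
  mean_col _ := h.mean _ _
  sq_row _ := h.sq _ _
  sq_col _ := h.sq _ _
  cross_conj i := h.cross_conj _ _ (Ne.symm i.2)
  cross i := h.cross _ _ (Ne.symm i.2)
  fourth i := h.fourth _ _ (Ne.symm i.2)

theorem IsElliptic.memLp_two [IsProbabilityMeasure P] (h : IsElliptic t A P) (i j : ι) :
    MemLp (fun ω => A ω i j) 2 P :=
  (h.memLp i j).mono_exponent (by norm_num)

variable [DecidableEq ι]

/-- The orthonormal family in row and column `j` along which the characteristic polynomial is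
expanded. -/
def borderBasis (t : ℝ) (A : Ω → Matrix ι ι ℂ) (j : ι) :
    Option (Option ({i // ¬ i = j} × {i // ¬ i = j})) → Ω → ℂ
  | none => fun _ => 1
  | some none => fun ω => A ω j j
  | some (some p) => wickProd t (fun (i : {i // ¬ i = j}) ω => A ω j i) (fun i ω => A ω i j) p.1 p.2

theorem IsElliptic.integral_borderBasis_mul_conj [IsProbabilityMeasure P]
    (h : IsElliptic t A P) (j : ι) (a b : Option (Option ({i // ¬ i = j} × {i // ¬ i = j}))) :
    ∫ ω, borderBasis t A j a ω * conj (borderBasis t A j b ω) ∂P = if a = b then 1 else 0 := by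
  have hsymm : ∀ a b, ∫ ω, borderBasis t A j a ω * conj (borderBasis t A j b ω) ∂P =
      conj (∫ ω, borderBasis t A j b ω * conj (borderBasis t A j a ω) ∂P) := fun a b => by
    rw [← integral_conj]
    simp [mul_comm]
  have h01 : ∫ ω, borderBasis t A j (some none) ω * conj (borderBasis t A j none ω) ∂P = 0 := by
    simpa [borderBasis] using h.mean j j
  have h02 : ∀ p, ∫ ω, borderBasis t A j (some (some p)) ω * conj (borderBasis t A j none ω) ∂P
      = 0 := fun p => by
    simpa [borderBasis] using (h.border j).integral_wickProd
  have h12 : ∀ p, ∫ ω, borderBasis t A j (some (some p)) ω *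
      conj (borderBasis t A j (some none) ω) ∂P = 0 := fun p => by
    -- The diagonal position is a block of its own, so A_jj is independent of the rest of the
    -- border.
    have hd : Disjoint (starBlocks j Set.univ) {s(j, j)} := by
      rw [Set.disjoint_singleton_right]
      rintro ⟨i, -, hi⟩
      exact i.2 (Sym2.congr_right.1 hi)
    have hle : ∀ S, blockSigma A S ≤ mΩ := fun S => blockSigma_le fun i k _ => h.measurable i k
    have m1 := (h.border j).measurable_wickProd (Set.mem_univ p.1) (Set.mem_univ p.2)
    have m2 := measurable_conj (measurable_blockSigma A (Set.mem_singleton s(j, j)))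
    simp only [borderBasis]
    rw [(indepFun_of_indep (h.indep _ _ hd) m1 m2).integral_fun_mul_eq_mul_integral
      (m1.mono (hle _) le_rfl).aestronglyMeasurable (m2.mono (hle _) le_rfl).aestronglyMeasurable,
      (h.border j).integral_wickProd, zero_mul]
  match a, b with
  | none, none => simp [borderBasis]
  | some none, none => simpa using h01
  | none, some none => rw [hsymm, h01]; simp
  | some (some p), none => rw [h02]; simp
  | none, some (some p) => rw [hsymm, h02]; simp
  | some none, some none => simpa [borderBasis] using h.sq j j
  | some (some p), some none => rw [h12]; simp
  | some none, some (some p) => rw [hsymm, h12]; simp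
  | some (some p), some (some q) =>
    simp only [borderBasis, Option.some.injEq]
    rw [(h.border j).integral_wickProd_mul_conj]
    simp [Prod.ext_iff]

theorem IsElliptic.memLp_borderBasis [IsProbabilityMeasure P] (h : IsElliptic t A P) (j : ι)
    (a : Option (Option ({i // ¬ i = j} × {i // ¬ i = j}))) :
    MemLp (borderBasis t A j a) 2 P :=
  match a with
  | none => memLp_const _
  | some none => h.memLp_two _ _
  | some (some _) => (h.border j).memLp_wickProd _ _

theorem measurable_borderBasis (h : IsElliptic t A P) (j : ι)
    (a : Option (Option ({i // ¬ i = j} × {i // ¬ i = j}))) :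
    Measurable[blockSigma A {b | j ∈ b}] (borderBasis t A j a) := by
  have hle : blockSigma A (starBlocks j Set.univ) ≤ blockSigma A {b | j ∈ b} :=
    blockSigma_le fun i k ⟨l, _, hl⟩ => measurable_blockSigma A (by simp [← hl])
  match a with
  | none => exact measurable_const
  | some none => exact measurable_blockSigma A (by simp)
  | some (some p) =>
    exact ((h.border j).measurable_wickProd (Set.mem_univ p.1) (Set.mem_univ p.2)).mono hle le_rfl

/-- The coefficients of the expansion along `borderBasis`. -/
def borderCoeff (t : ℝ) (ℓ : ℂ[X] →ₗ[ℂ] ℂ) {κ : Type*} [Fintype κ] [DecidableEq κ]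
    (B : Matrix κ κ ℂ) : Option (Option (κ × κ)) → ℂ
  | none => ℓ (raiseOp t B.charpoly)
  | some none => -ℓ B.charpoly
  | some (some p) => -ℓ (B.charmatrix.adjugate p.1 p.2)

/-- Centring the products A_ji A_ij moves t times the trace of the minor's adjugate into the
constant coefficient. That trace is the derivative of the minor's characteristic polynomial, which
completes `raiseOp`. -/
theorem map_charpoly_eq_sum {Ω : Type*} [Fintype ι] (t : ℝ) (A : Ω → Matrix ι ι ℂ)
    (ℓ : ℂ[X] →ₗ[ℂ] ℂ) (j : ι) (ω : Ω) :
    ℓ (A ω).charpoly = ∑ a, borderCoeff t ℓ (deleteIndex (A ω) j) a * borderBasis t A j a ω := by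
  rw [map_charpoly_eq ℓ _ j, Fintype.sum_option, Fintype.sum_option, Fintype.sum_prod_type]
  simp only [borderCoeff, borderBasis, wickProd, mul_sub, Finset.sum_sub_distrib]
  have h : ℓ (raiseOp t (deleteIndex (A ω) j).charpoly) =
      ℓ (X * (deleteIndex (A ω) j).charpoly) -
        ∑ i, t * ℓ ((deleteIndex (A ω) j).charmatrix.adjugate i i) := by
    rw [raiseOp_apply, map_sub, map_C_mul, derivative_charpoly, map_sum, Finset.mul_sum]
  rw [h]
  simp only [mul_ite, mul_zero, Finset.sum_ite_eq, Finset.mem_univ, if_true, neg_mul,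
    Finset.sum_neg_distrib]
  simp only [mul_comm]
  ring

/-- The second moment of the characteristic polynomial of an elliptic matrix. -/
def charpolyMoment (t : ℝ) (ℓ : ℂ[X] →ₗ[ℂ] ℂ) (n : ℕ) : ℝ :=
  ∑ k ∈ Finset.range (n + 1), (n ! : ℝ) / k ! * ‖ℓ (hermitePoly t k)‖ ^ 2

/-- The second moment of the adjugate of the characteristic matrix of an elliptic matrix. -/
def adjugateMoment (t : ℝ) (ℓ : ℂ[X] →ₗ[ℂ] ℂ) (n : ℕ) : ℝ :=
  ∑ k ∈ Finset.range (n + 1), (n ! : ℝ) / k ! * (n - k) * ‖ℓ (hermitePoly t k)‖ ^ 2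

theorem adjugateMoment_succ (t : ℝ) (ℓ : ℂ[X] →ₗ[ℂ] ℂ) (n : ℕ) :
    adjugateMoment t ℓ (n + 1) = (n + 1) * (charpolyMoment t ℓ n + adjugateMoment t ℓ n) := by
  rw [adjugateMoment, Finset.sum_range_succ, charpolyMoment, adjugateMoment,
    ← Finset.sum_add_distrib, Finset.mul_sum]
  simp only [sub_self, mul_zero, zero_mul, add_zero, Nat.factorial_succ]
  refine Finset.sum_congr rfl fun k _ => ?_
  push_cast
  ring

/-- Composing with `raiseOp` shifts the Hermite index and gives weight k · n!/k!; the other two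
moments together give (n + 1 - k) · n!/k!. The weights add up to (n + 1)!/k!. Each sum extends to
the full range because its missing end term has weight zero. -/
theorem charpolyMoment_succ (t : ℝ) (ℓ : ℂ[X] →ₗ[ℂ] ℂ) (n : ℕ) :
    charpolyMoment t ℓ (n + 1) = charpolyMoment t (ℓ ∘ₗ raiseOp t) n +
      (charpolyMoment t ℓ n + adjugateMoment t ℓ n) := by
  have h1 : charpolyMoment t (ℓ ∘ₗ raiseOp t) n =
      ∑ k ∈ Finset.range (n + 2), (n ! : ℝ) / k ! * k * ‖ℓ (hermitePoly t k)‖ ^ 2 := by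
    rw [Finset.sum_range_succ']
    simp only [Nat.cast_zero, mul_zero, zero_mul, add_zero, charpolyMoment]
    refine Finset.sum_congr rfl fun k _ => ?_
    simp only [LinearMap.comp_apply, hermitePoly, Nat.factorial_succ]
    push_cast
    field_simp
  have h2 : charpolyMoment t ℓ n + adjugateMoment t ℓ n =
      ∑ k ∈ Finset.range (n + 2), (n ! : ℝ) / k ! * (n + 1 - k) * ‖ℓ (hermitePoly t k)‖ ^ 2 := by
    rw [Finset.sum_range_succ, charpolyMoment, adjugateMoment, ← Finset.sum_add_distrib]
    simp only [Nat.cast_add, Nat.cast_one, sub_self, mul_zero, zero_mul, add_zero]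
    refine Finset.sum_congr rfl fun k _ => ?_
    ring
  rw [h1, h2, ← Finset.sum_add_distrib, charpolyMoment]
  refine Finset.sum_congr rfl fun k _ => ?_
  rw [Nat.factorial_succ]
  push_cast
  ring

/-- The index type varies because minors live on subtypes, and ℓ varies because the recursion calls
the smaller case at ℓ ∘ `raiseOp`. The adjugate moments are part of the induction since they occur
as coefficients of the centred products. -/
theorem IsElliptic.integral_norm_sq [IsProbabilityMeasure P] (n : ℕ) :
    ∀ (ι : Type*) [Fintype ι] [DecidableEq ι], Fintype.card ι = n → ∀ A : Ω → Matrix ι ι ℂ,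
      IsElliptic t A P → ∀ ℓ : ℂ[X] →ₗ[ℂ] ℂ,
      (MemLp (fun ω => ℓ (A ω).charpoly) 2 P ∧
        ∀ i j, MemLp (fun ω => ℓ ((A ω).charmatrix.adjugate i j)) 2 P) ∧
      (∫ ω, ‖ℓ (A ω).charpoly‖ ^ 2 ∂P = charpolyMoment t ℓ n ∧
        ∑ i, ∑ j, ∫ ω, ‖ℓ ((A ω).charmatrix.adjugate i j)‖ ^ 2 ∂P = adjugateMoment t ℓ n) := by
  induction n with
  | zero =>
    intro ι _ _ hc A hA ℓ
    have : IsEmpty ι := Fintype.card_eq_zero_iff.1 hc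
    have e : ∀ ω, (A ω).charpoly = 1 := fun ω => by simp [Matrix.charpoly]
    simp only [e]
    refine ⟨⟨memLp_const _, fun i => isEmptyElim i⟩, ?_, ?_⟩
    · simp [charpolyMoment, hermitePoly]
    · simp [adjugateMoment]
  | succ n ih =>
    intro ι _ _ hc A hA ℓ
    have hc' : ∀ j : ι, Fintype.card {i // ¬ i = j} = n := fun j => by
      simp [Fintype.card_subtype_compl, hc]
    have ih' := fun j => ih {i // ¬ i = j} (hc' j) (fun ω => deleteIndex (A ω) j)
      (hA.submatrix Subtype.val_injective)
    have hle : ∀ S, blockSigma A S ≤ mΩ := fun S => blockSigma_le fun i k _ => hA.measurable i k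
    have hind : ∀ j : ι, Indep (blockSigma A {b | j ∉ b}) (blockSigma A {b | j ∈ b}) P :=
      fun j => hA.indep _ _ (Set.disjoint_left.2 fun b h1 h2 => h1 h2)
    have hmeas : ∀ j ℓ, _ := fun j => measurable_map_charpoly_and_adjugate
      (m := blockSigma A {b | j ∉ b}) n {i // ¬ i = j} (hc' j) (fun ω => deleteIndex (A ω) j)
      (fun i k => measurable_blockSigma A (by simp [Ne.symm i.2, Ne.symm k.2]))
    have hcol : ∀ j (i : {i // ¬ i = j}),
        MemLp (fun ω => ℓ ((A ω).charmatrix.adjugate i j)) 2 P ∧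
        ∫ ω, ‖ℓ ((A ω).charmatrix.adjugate i j)‖ ^ 2 ∂P = ∑ k,
          ∫ ω, ‖ℓ ((deleteIndex (A ω) j).charmatrix.adjugate i k)‖ ^ 2 ∂P := by
      intro j i
      simp only [map_adjugate_ne ℓ _ j i]
      refine integral_norm_sq_sum_mul (hle _) (hle _) (hind j) (fun k => (hmeas j ℓ).2 i k)
        (fun k => measurable_blockSigma A (by simp)) (fun k => (ih' j ℓ).1.2 i k)
        (fun k => hA.memLp_two _ _) fun k l => ?_
      by_cases hkl : k = l
      · subst hkl
        simpa using hA.sq _ _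
      · rw [(hA.border j).integral_mul_of_disjoint (S := {k}) (T := {l}) (by simpa using hkl)
          ((hA.border j).measurable_col rfl)
          (measurable_conj ((hA.border j).measurable_col rfl)), hA.mean, zero_mul, if_neg hkl]
    have hdet : ∀ j, MemLp (fun ω => ℓ (A ω).charpoly) 2 P ∧
        ∫ ω, ‖ℓ (A ω).charpoly‖ ^ 2 ∂P = ∑ a,
          ∫ ω, ‖borderCoeff t ℓ (deleteIndex (A ω) j) a‖ ^ 2 ∂P := by
      intro j
      simp only [map_charpoly_eq_sum t A ℓ j]
      refine integral_norm_sq_sum_mul (hle _) (hle _) (hind j) (fun a => ?_)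
        (measurable_borderBasis hA j) (fun a => ?_) (hA.memLp_borderBasis j)
        (hA.integral_borderBasis_mul_conj j)
      · match a with
        | none => exact (hmeas j (ℓ ∘ₗ raiseOp t)).1
        | some none => exact (hmeas j ℓ).1.neg
        | some (some p) => exact ((hmeas j ℓ).2 p.1 p.2).neg
      · match a with
        | none => exact (ih' j (ℓ ∘ₗ raiseOp t)).1.1
        | some none => exact (ih' j ℓ).1.1.neg
        | some (some p) => exact ((ih' j ℓ).1.2 p.1 p.2).neg
    -- Any single index serves for the characteristic polynomial; for the adjugate, column j is
    -- expanded along its own index j.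
    obtain ⟨j₀⟩ : Nonempty ι := Fintype.card_pos_iff.1 (by omega)
    refine ⟨⟨(hdet j₀).1, fun i j => ?_⟩, ?_, ?_⟩
    · by_cases hij : i = j
      · subst hij
        simp only [adjugate_charmatrix_same]
        exact (ih' i ℓ).1.1
      · exact (hcol j ⟨i, hij⟩).1
    · rw [(hdet j₀).2, Fintype.sum_option, Fintype.sum_option, Fintype.sum_prod_type,
        charpolyMoment_succ]
      simp only [borderCoeff, norm_neg]
      rw [(ih' j₀ ℓ).2.1, (ih' j₀ ℓ).2.2]
      congr 1
      exact (ih' j₀ (ℓ ∘ₗ raiseOp t)).2.1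
    · rw [Finset.sum_comm, adjugateMoment_succ]
      have : ∀ j, ∑ i, ∫ ω, ‖ℓ ((A ω).charmatrix.adjugate i j)‖ ^ 2 ∂P =
          charpolyMoment t ℓ n + adjugateMoment t ℓ n := fun j => by
        rw [Fintype.sum_eq_add_sum_subtype_ne _ j]
        congr 1
        · simp only [adjugate_charmatrix_same]
          exact (ih' j ℓ).2.1
        · rw [← (ih' j ℓ).2.2]
          exact Finset.sum_congr rfl fun i _ => (hcol j i).2
      simp [this, hc, mul_add]

end Moments

end EllipticGinibre

end

noncomputable section

namespace EllipticGinibre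

open scoped ComplexConjugate

/-! ### Moments of the standard Gaussian -/

section GaussianMoments

/-- Four derivatives at 0 of the moment generating function exp(s²/2); each sends a prefactor q to
q' + s q. -/
theorem integral_pow_four_gaussianReal : ∫ x, x ^ 4 ∂gaussianReal 0 1 = 3 := by
  have hd : ∀ q q' : ℝ → ℝ, (∀ s, HasDerivAt q (q' s) s) →
      deriv (fun s => q s * Real.exp (s ^ 2 / 2)) =
        fun s => (q' s + s * q s) * Real.exp (s ^ 2 / 2) := by
    intro q q' hq
    ext s
    have h1 : HasDerivAt (fun s : ℝ => s ^ 2 / 2) s s := by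
      simpa using (hasDerivAt_pow 2 s).div_const 2
    rw [((hq s).fun_mul h1.exp).deriv]
    ring
  have h0 : (∫ x, x ^ 4 ∂gaussianReal 0 1) =
      iteratedDeriv 4 (mgf (fun x ↦ x) (gaussianReal 0 1)) 0 := by
    rw [iteratedDeriv_mgf_zero] <;> simp
  have e0 : mgf (fun x ↦ x) (gaussianReal 0 1) = fun s => (1 : ℝ) * Real.exp (s ^ 2 / 2) := by
    rw [mgf_fun_id_gaussianReal]
    simp
  have e1 : deriv (fun s : ℝ => (1 : ℝ) * Real.exp (s ^ 2 / 2)) =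
      fun s => s * Real.exp (s ^ 2 / 2) := by
    rw [hd (fun _ => 1) (fun _ => 0) fun s => hasDerivAt_const s 1]
    simp
  have e2 := hd (fun s => s) (fun _ => 1) fun s => hasDerivAt_id' s
  have e3 := hd (fun s => 1 + s * s) (fun s => 1 * s + s * 1) fun s =>
    ((hasDerivAt_id' s).fun_mul (hasDerivAt_id' s)).const_add 1
  have e4 := hd (fun s => 1 * s + s * 1 + s * (1 + s * s))
    (fun s => 1 * 1 + 1 * 1 + (1 * (1 + s * s) + s * (1 * s + s * 1))) fun s =>
    (((hasDerivAt_id' s).const_mul 1).fun_add ((hasDerivAt_id' s).mul_const 1)).fun_add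
      ((hasDerivAt_id' s).fun_mul
        (((hasDerivAt_id' s).fun_mul (hasDerivAt_id' s)).const_add 1))
  rw [h0, e0, iteratedDeriv_succ, iteratedDeriv_succ, iteratedDeriv_succ, iteratedDeriv_one,
    e1, e2, e3, e4]
  norm_num

theorem integral_sq_gaussianReal : ∫ x, x ^ 2 ∂gaussianReal 0 1 = 1 := by
  have h := variance_fun_id_gaussianReal (μ := 0) (v := 1)
  rw [variance_eq_integral measurable_id'.aemeasurable] at h
  simpa using h

theorem integrable_pow_gaussianReal (k : ℕ) : Integrable (fun x => x ^ k) (gaussianReal 0 1) := by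
  have h := (memLp_id_gaussianReal (μ := 0) (v := 1) (k : NNReal))
  exact (h.integrable_norm_pow' (p := k)).mono' (by fun_prop) (ae_of_all _ fun x => by simp)

/-- The moments of the standard Gaussian. -/
def gaussianMoment (k : ℕ) : ℝ := ∫ x, x ^ k ∂gaussianReal 0 1

@[simp] theorem gaussianMoment_zero : gaussianMoment 0 = 1 := by simp [gaussianMoment]

@[simp] theorem gaussianMoment_one : gaussianMoment 1 = 0 := by simp [gaussianMoment]

@[simp] theorem gaussianMoment_two : gaussianMoment 2 = 1 := integral_sq_gaussianReal

@[simp] theorem gaussianMoment_four : gaussianMoment 4 = 3 := integral_pow_four_gaussianReal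

end GaussianMoments

section HasMean

variable {Ω : Type*} {mΩ : MeasurableSpace Ω} {P : Measure Ω}

/-- `f` is integrable with integral `e`. -/
def HasMean (f : Ω → ℂ) (e : ℂ) (P : Measure Ω) : Prop := Integrable f P ∧ ∫ ω, f ω ∂P = e

theorem HasMean.add {f g : Ω → ℂ} {a b : ℂ} (hf : HasMean f a P) (hg : HasMean g b P) :
    HasMean (fun ω => f ω + g ω) (a + b) P :=
  ⟨hf.1.add hg.1, by rw [integral_add hf.1 hg.1, hf.2, hg.2]⟩

theorem HasMean.const_mul {f : Ω → ℂ} {a : ℂ} (c : ℂ) (hf : HasMean f a P) :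
    HasMean (fun ω => c * f ω) (c * a) P :=
  ⟨hf.1.const_mul c, by rw [integral_const_mul, hf.2]⟩

theorem HasMean.integral_eq {f g : Ω → ℂ} {a b : ℂ} (hf : HasMean f a P) (h : ∀ ω, g ω = f ω)
    (hab : a = b) : ∫ ω, g ω ∂P = b := by
  rw [← hab, ← hf.2]
  simp only [h]

/-- Four real random variables with the joint moments of independent standard Gaussians. -/
def HasGaussianMoments (x y u v : Ω → ℝ) (P : Measure Ω) : Prop :=
  ∀ a b c d : ℕ, HasMean (fun ω => (x ω : ℂ) ^ a * (y ω : ℂ) ^ b * (u ω : ℂ) ^ c * (v ω : ℂ) ^ d)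
    (gaussianMoment a * gaussianMoment b * gaussianMoment c * gaussianMoment d) P

end HasMean

/-! ### Moments of a pair of opposite entries -/

section Block

variable {Ω : Type*} {mΩ : MeasurableSpace Ω} {P : Measure Ω}

/-- The entry above the diagonal, in terms of independent Gaussians. -/
def upperEntry (a b x y u v : ℝ) : ℂ := ((a * x - b * v : ℝ) : ℂ) + (a * y + b * u : ℝ) * Complex.I

/-- The entry below the diagonal, in terms of independent Gaussians. -/
def lowerEntry (a b x y u v : ℝ) : ℂ := ((a * x + b * v : ℝ) : ℂ) + (b * u - a * y : ℝ) * Complex.I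

variable {x y u v : Ω → ℝ} {a b t : ℝ}

theorem integral_upperEntry (h : HasGaussianMoments x y u v P) :
    ∫ ω, upperEntry a b (x ω) (y ω) (u ω) (v ω) ∂P = 0 := by
  refine ((((h 1 0 0 0).const_mul (a : ℂ)).add ((h 0 0 0 1).const_mul (-b : ℂ))).add
    (((h 0 1 0 0).const_mul (a * Complex.I)).add
      ((h 0 0 1 0).const_mul (b * Complex.I)))).integral_eq (fun ω => ?_) (by simp)
  simp only [upperEntry]
  push_cast
  ring

theorem integral_lowerEntry (h : HasGaussianMoments x y u v P) :
    ∫ ω, lowerEntry a b (x ω) (y ω) (u ω) (v ω) ∂P = 0 := by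
  refine ((((h 1 0 0 0).const_mul (a : ℂ)).add ((h 0 0 0 1).const_mul (b : ℂ))).add
    (((h 0 1 0 0).const_mul (-a * Complex.I)).add
      ((h 0 0 1 0).const_mul (b * Complex.I)))).integral_eq (fun ω => ?_) (by simp)
  simp only [lowerEntry]
  push_cast
  ring

theorem integral_upperEntry_mul_conj (h : HasGaussianMoments x y u v P)
    (ha : a ^ 2 = (1 + t) / 4) (hb : b ^ 2 = (1 - t) / 4) :
    ∫ ω, upperEntry a b (x ω) (y ω) (u ω) (v ω) *
      conj (upperEntry a b (x ω) (y ω) (u ω) (v ω)) ∂P = 1 := by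
  have ha' : (a : ℂ) ^ 2 = (1 + t) / 4 := by exact_mod_cast ha
  have hb' : (b : ℂ) ^ 2 = (1 - t) / 4 := by exact_mod_cast hb
  refine (((((h 2 0 0 0).const_mul (a ^ 2 : ℂ)).add ((h 0 2 0 0).const_mul (a ^ 2 : ℂ))).add
    (((h 0 0 2 0).const_mul (b ^ 2 : ℂ)).add ((h 0 0 0 2).const_mul (b ^ 2 : ℂ)))).add
    (((h 1 0 0 1).const_mul (-2 * a * b : ℂ)).add ((h 0 1 1 0).const_mul (2 * a * b : ℂ)))
      ).integral_eq (fun ω => ?_) ?_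
  · simp only [upperEntry, map_add, map_mul, Complex.conj_ofReal, Complex.conj_I]
    push_cast
    linear_combination (-(a * y ω + b * u ω : ℂ) ^ 2) * Complex.I_sq
  · simp [ha', hb']
    ring

theorem integral_lowerEntry_mul_conj (h : HasGaussianMoments x y u v P)
    (ha : a ^ 2 = (1 + t) / 4) (hb : b ^ 2 = (1 - t) / 4) :
    ∫ ω, lowerEntry a b (x ω) (y ω) (u ω) (v ω) *
      conj (lowerEntry a b (x ω) (y ω) (u ω) (v ω)) ∂P = 1 := by
  have ha' : (a : ℂ) ^ 2 = (1 + t) / 4 := by exact_mod_cast ha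
  have hb' : (b : ℂ) ^ 2 = (1 - t) / 4 := by exact_mod_cast hb
  refine (((((h 2 0 0 0).const_mul (a ^ 2 : ℂ)).add ((h 0 2 0 0).const_mul (a ^ 2 : ℂ))).add
    (((h 0 0 2 0).const_mul (b ^ 2 : ℂ)).add ((h 0 0 0 2).const_mul (b ^ 2 : ℂ)))).add
    (((h 1 0 0 1).const_mul (2 * a * b : ℂ)).add ((h 0 1 1 0).const_mul (-2 * a * b : ℂ)))
      ).integral_eq (fun ω => ?_) ?_
  · simp only [lowerEntry, map_add, map_mul, Complex.conj_ofReal, Complex.conj_I]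
    push_cast
    linear_combination (-(b * u ω - a * y ω : ℂ) ^ 2) * Complex.I_sq
  · simp [ha', hb']
    ring

theorem integral_upperEntry_mul_conj_lowerEntry (h : HasGaussianMoments x y u v P) :
    ∫ ω, upperEntry a b (x ω) (y ω) (u ω) (v ω) *
      conj (lowerEntry a b (x ω) (y ω) (u ω) (v ω)) ∂P = 0 := by
  refine (((((h 2 0 0 0).const_mul (a ^ 2 : ℂ)).add ((h 0 2 0 0).const_mul (-a ^ 2 : ℂ))).add
    (((h 0 0 2 0).const_mul (b ^ 2 : ℂ)).add ((h 0 0 0 2).const_mul (-b ^ 2 : ℂ)))).add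
    (((h 1 1 0 0).const_mul (2 * a ^ 2 * Complex.I : ℂ)).add
      ((h 0 0 1 1).const_mul (2 * b ^ 2 * Complex.I : ℂ)))).integral_eq (fun ω => ?_) ?_
  · simp only [upperEntry, lowerEntry, map_add, map_mul, Complex.conj_ofReal, Complex.conj_I]
    push_cast
    linear_combination (-(a * y ω + b * u ω : ℂ) * (b * u ω - a * y ω)) * Complex.I_sq
  · simp

theorem upperEntry_mul_lowerEntry (a b x y u v : ℝ) :
    upperEntry a b x y u v * lowerEntry a b x y u v =
      (a ^ 2 * x ^ 2 + a ^ 2 * y ^ 2 - b ^ 2 * u ^ 2 - b ^ 2 * v ^ 2 : ℝ) +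
        (2 * a * b * (x * u + y * v) : ℝ) * Complex.I := by
  simp only [upperEntry, lowerEntry]
  push_cast
  linear_combination ((a * y + b * u : ℂ) * (b * u - a * y)) * Complex.I_sq

theorem integral_upperEntry_mul_lowerEntry (h : HasGaussianMoments x y u v P)
    (ha : a ^ 2 = (1 + t) / 4) (hb : b ^ 2 = (1 - t) / 4) :
    ∫ ω, upperEntry a b (x ω) (y ω) (u ω) (v ω) *
      lowerEntry a b (x ω) (y ω) (u ω) (v ω) ∂P = t := by
  have ha' : (a : ℂ) ^ 2 = (1 + t) / 4 := by exact_mod_cast ha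
  have hb' : (b : ℂ) ^ 2 = (1 - t) / 4 := by exact_mod_cast hb
  refine (((((h 2 0 0 0).const_mul (a ^ 2 : ℂ)).add ((h 0 2 0 0).const_mul (a ^ 2 : ℂ))).add
    (((h 0 0 2 0).const_mul (-b ^ 2 : ℂ)).add ((h 0 0 0 2).const_mul (-b ^ 2 : ℂ)))).add
    (((h 1 0 1 0).const_mul (2 * a * b * Complex.I : ℂ)).add
      ((h 0 1 0 1).const_mul (2 * a * b * Complex.I : ℂ)))).integral_eq (fun ω => ?_) ?_
  · rw [upperEntry_mul_lowerEntry]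
    push_cast
    ring
  · simp [ha', hb']
    ring

/-- With α = a² and β = b², the squared modulus of the product is (α(x² + y²) - β(u² + v²))² +
4αβ(xu + yv)². The mixed terms have means -8αβ and 8αβ and cancel, leaving 8α² + 8β² = 1 + t². -/
theorem integral_upperEntry_mul_lowerEntry_mul_conj (h : HasGaussianMoments x y u v P)
    (ha : a ^ 2 = (1 + t) / 4) (hb : b ^ 2 = (1 - t) / 4) :
    ∫ ω, (upperEntry a b (x ω) (y ω) (u ω) (v ω) * lowerEntry a b (x ω) (y ω) (u ω) (v ω)) *
      conj (upperEntry a b (x ω) (y ω) (u ω) (v ω) *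
        lowerEntry a b (x ω) (y ω) (u ω) (v ω)) ∂P = 1 + t ^ 2 := by
  have ha' : (a : ℂ) ^ 2 = (1 + t) / 4 := by exact_mod_cast ha
  have hb' : (b : ℂ) ^ 2 = (1 - t) / 4 := by exact_mod_cast hb
  set α : ℂ := (a : ℂ) ^ 2 with hα
  set β : ℂ := (b : ℂ) ^ 2 with hβ
  refine ((((((h 4 0 0 0).const_mul (α ^ 2)).add ((h 0 4 0 0).const_mul (α ^ 2))).add
    ((h 2 2 0 0).const_mul (2 * α ^ 2))).add
    ((((h 0 0 4 0).const_mul (β ^ 2)).add ((h 0 0 0 4).const_mul (β ^ 2))).add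
    ((h 0 0 2 2).const_mul (2 * β ^ 2)))).add
    (((((h 2 0 2 0).const_mul (2 * α * β)).add ((h 2 0 0 2).const_mul (-2 * α * β))).add
    (((h 0 2 2 0).const_mul (-2 * α * β)).add ((h 0 2 0 2).const_mul (2 * α * β)))).add
    ((h 1 1 1 1).const_mul (8 * α * β)))).integral_eq (fun ω => ?_) ?_
  · rw [upperEntry_mul_lowerEntry]
    simp only [map_add, map_mul, Complex.conj_ofReal, Complex.conj_I]
    push_cast
    rw [hα, hβ]
    linear_combination (-(2 * a * b * (x ω * u ω + y ω * v ω) : ℂ) ^ 2) * Complex.I_sq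
  · simp [ha', hb']
    ring

end Block

/-! ### The Gaussian model satisfies the elliptic axioms -/

section Model

variable (n : ℕ)

/-- The law of the pairs of Gaussians which generate the two independent GUE matrices. -/
def pairLaw : Measure (Fin n × Fin n → ℝ × ℝ) :=
  Measure.pi fun _ => (gaussianReal 0 1).prod (gaussianReal 0 1)

instance : IsProbabilityMeasure (pairLaw n) := by
  unfold pairLaw
  infer_instance

/-- The elliptic matrix as a function of the Gaussians. -/
def modelMatrix (t : ℝ) (ω : Fin n × Fin n → ℝ × ℝ) : Matrix (Fin n) (Fin n) ℂ :=
  ellipticMatrix t (hermitianOf fun p => (ω p).1) (hermitianOf fun p => (ω p).2)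

variable {n}

theorem hasMean_pair (p : Fin n × Fin n) (a c : ℕ) :
    HasMean (fun ω => ((ω p).1 : ℂ) ^ a * ((ω p).2 : ℂ) ^ c)
      (gaussianMoment a * gaussianMoment c) (pairLaw n) := by
  have hmp := measurePreserving_eval
    (fun _ : Fin n × Fin n => (gaussianReal 0 1).prod (gaussianReal 0 1)) p
  have hi : ∀ k : ℕ, Integrable (fun x : ℝ => (x : ℂ) ^ k) (gaussianReal 0 1) := fun k => by
    simpa using (integrable_pow_gaussianReal k).ofReal (𝕜 := ℂ)
  have he : ∀ k : ℕ, ∫ x : ℝ, (x : ℂ) ^ k ∂gaussianReal 0 1 = gaussianMoment k := fun k => by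
    rw [gaussianMoment, ← integral_complex_ofReal]
    simp
  have h1 : Integrable (fun z : ℝ × ℝ => (z.1 : ℂ) ^ a * (z.2 : ℂ) ^ c)
    ((gaussianReal 0 1).prod (gaussianReal 0 1)) := (hi a).mul_prod (hi c)
  refine ⟨hmp.integrable_comp_of_integrable h1, ?_⟩
  have h2 := integral_map (μ := pairLaw n) (φ := Function.eval p) hmp.measurable.aemeasurable
    (f := fun z : ℝ × ℝ => (z.1 : ℂ) ^ a * (z.2 : ℂ) ^ c)
    (by rw [pairLaw, hmp.map_eq]; exact h1.1)
  rw [pairLaw, hmp.map_eq, integral_prod_mul (fun x : ℝ => (x : ℂ) ^ a) (fun x : ℝ => (x : ℂ) ^ c),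
    he, he] at h2
  exact h2.symm

theorem iIndepFun_eval : iIndepFun (fun (p : Fin n × Fin n) (ω : Fin n × Fin n → ℝ × ℝ) => ω p)
    (pairLaw n) :=
  iIndepFun_pi (X := fun _ z => z) fun _ => aemeasurable_id

theorem hasGaussianMoments {p q : Fin n × Fin n} (hpq : p ≠ q) :
    HasGaussianMoments (fun ω => (ω p).1) (fun ω => (ω q).1) (fun ω => (ω p).2)
      (fun ω => (ω q).2) (pairLaw n) := by
  intro a b c d
  have h1 := hasMean_pair p a c
  have h2 := hasMean_pair q b d
  have hind : IndepFun (fun ω : Fin n × Fin n → ℝ × ℝ => ((ω p).1 : ℂ) ^ a * ((ω p).2 : ℂ) ^ c)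
      (fun ω => ((ω q).1 : ℂ) ^ b * ((ω q).2 : ℂ) ^ d) (pairLaw n) :=
    (iIndepFun_eval.indepFun hpq).comp
      (φ := fun z : ℝ × ℝ => (z.1 : ℂ) ^ a * (z.2 : ℂ) ^ c)
      (ψ := fun z : ℝ × ℝ => (z.1 : ℂ) ^ b * (z.2 : ℂ) ^ d) (by fun_prop) (by fun_prop)
  have e : ∀ ω : Fin n × Fin n → ℝ × ℝ,
      ((ω p).1 : ℂ) ^ a * ((ω q).1 : ℂ) ^ b * ((ω p).2 : ℂ) ^ c * ((ω q).2 : ℂ) ^ d =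
      (((ω p).1 : ℂ) ^ a * ((ω p).2 : ℂ) ^ c) * (((ω q).1 : ℂ) ^ b * ((ω q).2 : ℂ) ^ d) :=
    fun ω => by ring
  simp only [e]
  refine ⟨hind.integrable_mul h1.1 h2.1, ?_⟩
  rw [hind.integral_fun_mul_eq_mul_integral h1.1.1 h2.1.1, h1.2, h2.2]
  ring

theorem sqrt_two_inv_sq : ((Real.sqrt 2)⁻¹) ^ 2 = 1 / 2 := by
  rw [inv_pow, Real.sq_sqrt (by norm_num)]
  norm_num

theorem modelMatrix_upper (t : ℝ) {i j : Fin n} (h : i < j) (ω : Fin n × Fin n → ℝ × ℝ) :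
    modelMatrix n t ω i j = upperEntry (Real.sqrt ((1 + t) / 2) * (Real.sqrt 2)⁻¹)
      (Real.sqrt ((1 - t) / 2) * (Real.sqrt 2)⁻¹) (ω (i, j)).1 (ω (j, i)).1 (ω (i, j)).2
        (ω (j, i)).2 := by
  simp only [modelMatrix, ellipticMatrix, hermitianOf, upperEntry, Matrix.add_apply,
    Matrix.smul_apply, Matrix.of_apply, smul_eq_mul, if_neg h.ne, if_pos h]
  push_cast
  rw [div_eq_mul_inv, div_eq_mul_inv]
  linear_combination ((Real.sqrt ((1 - t) / 2) : ℂ) * (Real.sqrt 2 : ℂ)⁻¹ * (ω (j, i)).2) *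
    Complex.I_sq

theorem modelMatrix_lower (t : ℝ) {i j : Fin n} (h : i < j) (ω : Fin n × Fin n → ℝ × ℝ) :
    modelMatrix n t ω j i = lowerEntry (Real.sqrt ((1 + t) / 2) * (Real.sqrt 2)⁻¹)
      (Real.sqrt ((1 - t) / 2) * (Real.sqrt 2)⁻¹) (ω (i, j)).1 (ω (j, i)).1 (ω (i, j)).2
        (ω (j, i)).2 := by
  simp only [modelMatrix, ellipticMatrix, hermitianOf, lowerEntry, Matrix.add_apply,
    Matrix.smul_apply, Matrix.of_apply, smul_eq_mul, if_neg h.ne', if_neg h.not_gt]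
  push_cast
  rw [div_eq_mul_inv, div_eq_mul_inv]
  linear_combination (-(Real.sqrt ((1 - t) / 2) : ℂ) * (Real.sqrt 2 : ℂ)⁻¹ * (ω (j, i)).2) *
    Complex.I_sq

theorem modelMatrix_diag (t : ℝ) (i : Fin n) (ω : Fin n × Fin n → ℝ × ℝ) :
    modelMatrix n t ω i i = (Real.sqrt ((1 + t) / 2) : ℂ) * (ω (i, i)).1 +
      Complex.I * (Real.sqrt ((1 - t) / 2) : ℂ) * (ω (i, i)).2 := by
  simp [modelMatrix, ellipticMatrix, hermitianOf]

theorem memLp_coord (p : Fin n × Fin n) :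
    MemLp (fun ω => ((ω p).1 : ℂ)) 4 (pairLaw n) ∧
      MemLp (fun ω => ((ω p).2 : ℂ)) 4 (pairLaw n) := by
  have hmp := measurePreserving_eval
    (fun _ : Fin n × Fin n => (gaussianReal 0 1).prod (gaussianReal 0 1)) p
  have h : MemLp (fun x : ℝ => (x : ℂ)) 4 (gaussianReal 0 1) :=
    (memLp_id_gaussianReal' 4 (by norm_num)).ofReal
  exact ⟨h.comp_measurePreserving (measurePreserving_fst.comp hmp),
    h.comp_measurePreserving (measurePreserving_snd.comp hmp)⟩

theorem hermitianOf_eq_sum (i j : Fin n) :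
    ∃ c d : ℂ, ∀ g : Fin n × Fin n → ℝ, hermitianOf g i j = c * g (i, j) + d * g (j, i) := by
  simp only [hermitianOf, Matrix.of_apply]
  split_ifs with h1 h2
  · subst h1
    exact ⟨1, 0, fun g => by simp⟩
  · exact ⟨1 / (Real.sqrt 2 : ℂ), Complex.I / (Real.sqrt 2 : ℂ), fun g => by ring⟩
  · exact ⟨-Complex.I / (Real.sqrt 2 : ℂ), 1 / (Real.sqrt 2 : ℂ), fun g => by ring⟩

theorem modelMatrix_eq_linear (t : ℝ) (i j : Fin n) : ∃ c d c' d' : ℂ,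
    ∀ ω : Fin n × Fin n → ℝ × ℝ, modelMatrix n t ω i j =
      c * (ω (i, j)).1 + d * (ω (j, i)).1 + (c' * (ω (i, j)).2 + d' * (ω (j, i)).2) := by
  obtain ⟨c, d, h⟩ := hermitianOf_eq_sum i j
  refine ⟨Real.sqrt ((1 + t) / 2) * c, Real.sqrt ((1 + t) / 2) * d,
    Complex.I * Real.sqrt ((1 - t) / 2) * c, Complex.I * Real.sqrt ((1 - t) / 2) * d, fun ω => ?_⟩
  simp only [modelMatrix, ellipticMatrix, Matrix.add_apply, Matrix.smul_apply, smul_eq_mul, h]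
  ring

theorem isElliptic_modelMatrix {t : ℝ} (ht : t ∈ Set.Icc (0 : ℝ) 1) :
    IsElliptic t (modelMatrix n t) (pairLaw n) := by
  have ha0 : Real.sqrt ((1 + t) / 2) ^ 2 = (1 + t) / 2 := Real.sq_sqrt (by linarith [ht.1])
  have hb0 : Real.sqrt ((1 - t) / 2) ^ 2 = (1 - t) / 2 := Real.sq_sqrt (by linarith [ht.2])
  have ha : (Real.sqrt ((1 + t) / 2) * (Real.sqrt 2)⁻¹) ^ 2 = (1 + t) / 4 := by
    rw [mul_pow, ha0, sqrt_two_inv_sq]; ring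
  have hb : (Real.sqrt ((1 - t) / 2) * (Real.sqrt 2)⁻¹) ^ 2 = (1 - t) / 4 := by
    rw [mul_pow, hb0, sqrt_two_inv_sq]; ring
  have hg : ∀ {i j : Fin n}, i < j → HasGaussianMoments (fun ω => (ω (i, j)).1)
      (fun ω => (ω (j, i)).1) (fun ω => (ω (i, j)).2) (fun ω => (ω (j, i)).2) (pairLaw n) :=
    fun {i j} h => hasGaussianMoments (by simp [h.ne])
  refine ⟨fun i j => ?_, fun S T hST => ?_, fun i j => ?_, fun i j => ?_, fun i j => ?_,
    fun i j hij => ?_, fun i j hij => ?_, fun i j hij => ?_⟩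
  · obtain ⟨c, d, c', d', h⟩ := modelMatrix_eq_linear t i j
    simp only [h]
    fun_prop
  -- The block of {i, j} uses only the coordinates (i, j) and (j, i), so disjoint sets of blocks use
  -- disjoint sets of independent coordinates.
  · have hle : ∀ S : Set (Sym2 (Fin n)), blockSigma (modelMatrix n t) S ≤
        ⨆ p ∈ {p : Fin n × Fin n | s(p.1, p.2) ∈ S},
          MeasurableSpace.comap (fun ω : Fin n × Fin n → ℝ × ℝ => ω p) inferInstance := by
      intro S
      refine blockSigma_le fun i j hij => ?_
      have hm : ∀ p : Fin n × Fin n, s(p.1, p.2) ∈ S → Measurable[⨆ p ∈ {p : Fin n × Fin n |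
          s(p.1, p.2) ∈ S}, MeasurableSpace.comap (fun ω : Fin n × Fin n → ℝ × ℝ => ω p)
            inferInstance] (fun ω : Fin n × Fin n → ℝ × ℝ => ω p) := fun p hp => by
        rw [measurable_iff_comap_le]
        exact le_iSup₂_of_le (f := fun (p : Fin n × Fin n)
          (_ : p ∈ {p : Fin n × Fin n | s(p.1, p.2) ∈ S}) =>
            MeasurableSpace.comap (fun ω : Fin n × Fin n → ℝ × ℝ => ω p) inferInstance) p hp le_rfl
      have h1 := hm (i, j) hij
      have h2 := hm (j, i) (by rwa [Sym2.eq_swap])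
      obtain ⟨c, d, c', d', h⟩ := modelMatrix_eq_linear t i j
      simp only [h]
      have hL : Measurable fun z : (ℝ × ℝ) × (ℝ × ℝ) =>
          c * (z.1.1 : ℂ) + d * (z.2.1 : ℂ) + (c' * (z.1.2 : ℂ) + d' * (z.2.2 : ℂ)) := by fun_prop
      exact hL.comp (h1.prodMk h2)
    refine indep_of_indep_of_le_left (indep_of_indep_of_le_right
      (indep_iSup_of_disjoint (fun p => (measurable_pi_apply p).comap_le) iIndepFun_eval.iIndep
        ?_) (hle T)) (hle S)
    exact Set.disjoint_left.2 fun p h1 h2 => Set.disjoint_left.1 hST h1 h2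
  · obtain ⟨c, d, c', d', h⟩ := modelMatrix_eq_linear t i j
    simp only [h]
    exact (((memLp_coord _).1.const_mul c).add ((memLp_coord _).1.const_mul d)).add
      (((memLp_coord _).2.const_mul c').add ((memLp_coord _).2.const_mul d'))
  · rcases lt_trichotomy i j with h | h | h
    · simp only [modelMatrix_upper t h]
      exact integral_upperEntry (hg h)
    · subst h
      simp only [modelMatrix_diag]
      refine (((hasMean_pair (i, i) 1 0).const_mul (Real.sqrt ((1 + t) / 2) : ℂ)).add
        ((hasMean_pair (i, i) 0 1).const_mul (Complex.I * (Real.sqrt ((1 - t) / 2) : ℂ)))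
          ).integral_eq (fun ω => by ring) (by simp)
    · simp only [modelMatrix_lower t h]
      exact integral_lowerEntry (hg h)
  · rcases lt_trichotomy i j with h | h | h
    · simp only [modelMatrix_upper t h]
      exact integral_upperEntry_mul_conj (hg h) ha hb
    · subst h
      have ha' : (Real.sqrt ((1 + t) / 2) : ℂ) ^ 2 = (1 + t) / 2 := by exact_mod_cast ha0
      have hb' : (Real.sqrt ((1 - t) / 2) : ℂ) ^ 2 = (1 - t) / 2 := by exact_mod_cast hb0
      simp only [modelMatrix_diag]
      refine (((hasMean_pair (i, i) 2 0).const_mul ((Real.sqrt ((1 + t) / 2) : ℂ) ^ 2)).add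
        ((hasMean_pair (i, i) 0 2).const_mul ((Real.sqrt ((1 - t) / 2) : ℂ) ^ 2))
          ).integral_eq (fun ω => ?_) ?_
      · simp only [map_add, map_mul, Complex.conj_ofReal, Complex.conj_I]
        linear_combination (-((Real.sqrt ((1 - t) / 2) : ℂ) * (ω (i, i)).2) ^ 2) * Complex.I_sq
      · rw [ha', hb']
        simp
        ring
    · simp only [modelMatrix_lower t h]
      exact integral_lowerEntry_mul_conj (hg h) ha hb
  · rcases lt_or_gt_of_ne hij with h | h
    · simp only [modelMatrix_upper t h, modelMatrix_lower t h]
      exact integral_upperEntry_mul_conj_lowerEntry (hg h)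
    · simp only [modelMatrix_upper t h, modelMatrix_lower t h]
      rw [← map_zero (starRingEnd ℂ), ← integral_upperEntry_mul_conj_lowerEntry
        (a := Real.sqrt ((1 + t) / 2) * (Real.sqrt 2)⁻¹)
        (b := Real.sqrt ((1 - t) / 2) * (Real.sqrt 2)⁻¹) (hg h), ← integral_conj]
      simp [mul_comm]
  · rcases lt_or_gt_of_ne hij with h | h
    · simp only [modelMatrix_upper t h, modelMatrix_lower t h]
      exact integral_upperEntry_mul_lowerEntry (hg h) ha hb
    · simp only [modelMatrix_upper t h, modelMatrix_lower t h]
      rw [← integral_upperEntry_mul_lowerEntry (hg h) ha hb]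
      simp [mul_comm]
  · rcases lt_or_gt_of_ne hij with h | h
    · simp only [modelMatrix_upper t h, modelMatrix_lower t h]
      exact integral_upperEntry_mul_lowerEntry_mul_conj (hg h) ha hb
    · simp only [modelMatrix_upper t h, modelMatrix_lower t h]
      rw [← integral_upperEntry_mul_lowerEntry_mul_conj (hg h) ha hb]
      refine integral_congr_ae (ae_of_all _ fun ω => ?_)
      simp only [map_mul]
      ring

end Model

end EllipticGinibre

end

noncomputable section

namespace EllipticGinibre

open Polynomial
open scoped Nat

/-! ### Cauchy estimate for Hermite polynomials, and Stirling's bound -/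

section Hermite

/-- The exponential generating function of the Hermite polynomials, in the variable `m * u`. -/
def hermiteGen (t : ℝ) (lam m u : ℂ) : ℂ := Complex.exp (lam * (m * u) - t * (m * u) ^ 2 / 2)

theorem hasDerivAt_hermiteGen (t : ℝ) (lam m u : ℂ) :
    HasDerivAt (hermiteGen t lam m) (m * (lam - t * (m * u)) * hermiteGen t lam m u) u := by
  have h1 : HasDerivAt (fun u => m * u) m u := by simpa using (hasDerivAt_id' u).const_mul m
  have h2 := ((h1.const_mul lam).sub (((h1.pow 2).const_mul (t : ℂ)).div_const 2)).cexp
  refine h2.congr_deriv ?_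
  simp [hermiteGen]
  ring

/-- Differentiating Q(λ - tmu) times the exponential replaces Q by m(XQ - tQ') at the same shifted
point, which is one step of `raiseOp`. -/
theorem iteratedDeriv_hermiteGen (t : ℝ) (lam m : ℂ) (k : ℕ) :
    iteratedDeriv k (hermiteGen t lam m) = fun u =>
      m ^ k * (hermitePoly t k).eval (lam - t * (m * u)) * hermiteGen t lam m u := by
  induction k with
  | zero => ext u; simp [hermitePoly]
  | succ k ih =>
    rw [iteratedDeriv_succ, ih]
    ext u
    have h1 : HasDerivAt (fun u => lam - t * (m * u)) (-(t * m)) u := by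
      simpa using (((hasDerivAt_id' u).const_mul m).const_mul (t : ℂ)).const_sub lam
    have h2 := ((hermitePoly t k).hasDerivAt (lam - t * (m * u))).comp u h1
    have h3 := (h2.const_mul (m ^ k)).mul (hasDerivAt_hermiteGen t lam m u)
    refine h3.deriv.trans ?_
    simp only [hermitePoly, raiseOp_apply, eval_sub, eval_mul, eval_X, eval_C, Function.comp]
    ring

theorem norm_eval_hermitePoly_le (t : ℝ) (lam m : ℂ) (k : ℕ) {ρ : ℝ} (hρ : 0 < ρ) :
    ‖m‖ ^ k * ‖(hermitePoly t k).eval lam‖ ≤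
      k ! * (ρ ^ k)⁻¹ * ((2 * Real.pi)⁻¹ *
        ∫ θ in (0 : ℝ)..2 * Real.pi, ‖hermiteGen t lam m (circleMap 0 ρ θ)‖) := by
  have hd : Differentiable ℂ (hermiteGen t lam m) := fun u =>
    (hasDerivAt_hermiteGen t lam m u).differentiableAt
  have h1 := DiffContOnCl.circleIntegral_one_div_sub_center_pow_smul hρ k
    (hd.diffContOnCl (s := Metric.ball (0 : ℂ) ρ))
  have h2 : iteratedDeriv k (hermiteGen t lam m) 0 = m ^ k * (hermitePoly t k).eval lam := by
    rw [iteratedDeriv_hermiteGen]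
    simp [hermiteGen]
  rw [h2] at h1
  have h3 : ‖(2 * Real.pi * Complex.I / k ! : ℂ) • (m ^ k * (hermitePoly t k).eval lam)‖ ≤
      (ρ ^ k)⁻¹ * ∫ θ in (0 : ℝ)..2 * Real.pi, ‖hermiteGen t lam m (circleMap 0 ρ θ)‖ := by
    rw [← h1, ← intervalIntegral.integral_const_mul]
    refine (intervalIntegral.norm_integral_le_integral_norm Real.two_pi_pos.le).trans_eq ?_
    refine intervalIntegral.integral_congr fun θ _ => ?_
    simp only [norm_smul, deriv_circleMap, norm_mul, norm_circleMap_zero, Complex.norm_I, mul_one,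
      sub_zero, norm_div, norm_one, norm_pow, abs_of_pos hρ]
    field_simp
    ring
  have hk : (0 : ℝ) < k ! := by positivity
  have h4 : ‖(2 * Real.pi * Complex.I / k ! : ℂ) • (m ^ k * (hermitePoly t k).eval lam)‖ =
      2 * Real.pi / k ! * (‖m‖ ^ k * ‖(hermitePoly t k).eval lam‖) := by
    simp [abs_of_pos Real.pi_pos]
  rw [h4] at h3
  have hp := Real.pi_pos
  calc ‖m‖ ^ k * ‖(hermitePoly t k).eval lam‖
      = k ! * (2 * Real.pi)⁻¹ *
        (2 * Real.pi / k ! * (‖m‖ ^ k * ‖(hermitePoly t k).eval lam‖)) := by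
        field_simp
    _ ≤ k ! * (2 * Real.pi)⁻¹ * ((ρ ^ k)⁻¹ *
        ∫ θ in (0 : ℝ)..2 * Real.pi, ‖hermiteGen t lam m (circleMap 0 ρ θ)‖) := by gcongr
    _ = _ := by ring

/-- On [-π, π] one has 1 - cos θ ≥ 2θ²/π², so a Gaussian integral dominates. It yields the constant
π/8 ≤ 1. -/
theorem integral_exp_cos_le {c : ℝ} (hc : 0 < c) :
    ((2 * Real.pi)⁻¹ * ∫ θ in (0 : ℝ)..2 * Real.pi, Real.exp (-(c * (1 - Real.cos θ)))) ^ 2 ≤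
      c⁻¹ := by
  have hp := Real.pi_pos
  have hper : Function.Periodic (fun θ => Real.exp (-(c * (1 - Real.cos θ)))) (2 * Real.pi) :=
    fun θ => by simp
  have h1 : ∫ θ in (0 : ℝ)..2 * Real.pi, Real.exp (-(c * (1 - Real.cos θ))) =
      ∫ θ in (-Real.pi)..Real.pi, Real.exp (-(c * (1 - Real.cos θ))) := by
    have := hper.intervalIntegral_add_eq 0 (-Real.pi)
    rw [zero_add] at this
    rw [this]
    congr 1
    ring
  set b : ℝ := 2 * c / Real.pi ^ 2 with hb
  have hb0 : 0 < b := by positivity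
  have hI : Integrable fun θ : ℝ => Real.exp (-b * θ ^ 2) := integrable_exp_neg_mul_sq hb0
  have h2 : ∫ θ in (-Real.pi)..Real.pi, Real.exp (-(c * (1 - Real.cos θ))) ≤
      Real.sqrt (Real.pi / b) := by
    rw [← integral_gaussian b]
    calc ∫ θ in (-Real.pi)..Real.pi, Real.exp (-(c * (1 - Real.cos θ)))
        ≤ ∫ θ in (-Real.pi)..Real.pi, Real.exp (-b * θ ^ 2) := by
          refine intervalIntegral.integral_mono_on (by linarith)
            (Continuous.intervalIntegrable (by fun_prop) _ _)
            (Continuous.intervalIntegrable (by fun_prop) _ _) fun θ hθ => ?_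
          rw [Real.exp_le_exp]
          have := Real.cos_le_one_sub_mul_cos_sq (abs_le.2 ⟨hθ.1, hθ.2⟩)
          have h3 : c * (2 / Real.pi ^ 2 * θ ^ 2) ≤ c * (1 - Real.cos θ) := by gcongr; linarith
          have h4 : b * θ ^ 2 = c * (2 / Real.pi ^ 2 * θ ^ 2) := by rw [hb]; ring
          linarith
      _ ≤ ∫ θ : ℝ, Real.exp (-b * θ ^ 2) := by
          rw [intervalIntegral.integral_of_le (by linarith)]
          exact setIntegral_le_integral hI (ae_of_all _ fun θ => (Real.exp_pos _).le)
  have h0 : 0 ≤ ∫ θ in (-Real.pi)..Real.pi, Real.exp (-(c * (1 - Real.cos θ))) :=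
    intervalIntegral.integral_nonneg (by linarith) fun θ _ => (Real.exp_pos _).le
  rw [h1]
  calc ((2 * Real.pi)⁻¹ * ∫ θ in (-Real.pi)..Real.pi, Real.exp (-(c * (1 - Real.cos θ)))) ^ 2
      ≤ ((2 * Real.pi)⁻¹ * Real.sqrt (Real.pi / b)) ^ 2 := by gcongr
    _ = Real.pi / 8 * c⁻¹ := by
        rw [mul_pow, Real.sq_sqrt (by positivity), hb]
        field_simp
        ring
    _ ≤ 1 * c⁻¹ := by
        gcongr
        linarith [Real.pi_le_four]
    _ = c⁻¹ := one_mul _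

/-- Stirling's sequence decreases from its first value e/√2. -/
theorem factorial_mul_exp_le {m : ℕ} (hm : 1 ≤ m) :
    (m ! : ℝ) * Real.exp m ≤ Real.exp 1 * Real.sqrt m * (m : ℝ) ^ m := by
  obtain ⟨k, rfl⟩ : ∃ k, m = k + 1 := ⟨m - 1, by omega⟩
  have h : Stirling.stirlingSeq (k + 1) ≤ Stirling.stirlingSeq 1 :=
    Stirling.stirlingSeq'_antitone (Nat.zero_le k)
  have hm0 : (0 : ℝ) < ((k + 1 : ℕ) : ℝ) := by positivity
  rw [Stirling.stirlingSeq_one, Stirling.stirlingSeq, div_le_div_iff₀ (by positivity)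
    (by positivity), Real.sqrt_mul (by norm_num), div_pow, ← Real.exp_nat_mul, mul_one] at h
  have h2 : (0 : ℝ) < Real.sqrt 2 := by positivity
  have he := Real.exp_pos ((k + 1 : ℕ) : ℝ)
  have h3 : Real.sqrt 2 * (((k + 1)! : ℝ) * Real.exp ((k + 1 : ℕ) : ℝ)) ≤
      Real.sqrt 2 * (Real.exp 1 * Real.sqrt ((k + 1 : ℕ) : ℝ) * ((k + 1 : ℕ) : ℝ) ^ (k + 1)) := by
    have := mul_le_mul_of_nonneg_right h he.le
    refine (le_of_eq (by ring)).trans (this.trans (le_of_eq ?_))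
    field_simp
  exact le_of_mul_le_mul_left h3 h2

end Hermite

/-! ### Uniform second-moment bound inside the disk -/

section Bound

/-- With w = tz², the exponent recentred at u = 1 is n(1 + w/2 + (u - 1) - w(u - 1)²/2). On |u| = ρ,
Re(u - 1) = (ρ² - 1)/2 - |u - 1|²/2, and this negative square absorbs the quadratic term because |w|
≤ 1. Finally |u - 1|² ≥ 2ρ(1 - cos θ). -/
theorem norm_hermiteGen_le {n : ℕ} {t : ℝ} {z lam m : ℂ} (hm : t * m ^ 2 = n * (t * z ^ 2))
    (hlam : lam * m = n * (1 + t * z ^ 2)) (hw : ‖t * z ^ 2‖ ≤ 1) {ρ : ℝ} (hρ : 0 < ρ) (θ : ℝ) :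
    ‖hermiteGen t lam m (circleMap 0 ρ θ)‖ ≤
      Real.exp (n * (1 + (t * z ^ 2 : ℂ).re / 2) + n * (ρ ^ 2 - 1) / 2) *
        Real.exp (-(n * (1 - ‖t * z ^ 2‖) * ρ * (1 - Real.cos θ))) := by
  set w : ℂ := t * z ^ 2
  set u : ℂ := circleMap 0 ρ θ with hu
  have hure : u.re = ρ * Real.cos θ := by simp [hu, circleMap, Complex.exp_ofReal_mul_I_re]
  have hnu : ‖u - 1‖ ^ 2 = ρ ^ 2 + 1 - 2 * u.re := by
    have : ‖u‖ = ρ := by rw [hu, norm_circleMap_zero, abs_of_pos hρ]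
    rw [← this, Complex.sq_norm, Complex.sq_norm, Complex.normSq_apply, Complex.normSq_apply]
    simp
    ring
  rw [hermiteGen, Complex.norm_exp, ← Real.exp_add, Real.exp_le_exp]
  have e : lam * (m * u) - t * (m * u) ^ 2 / 2 =
      ((n : ℝ) : ℂ) * (1 + w / 2 + (u - 1) - w * (u - 1) ^ 2 / 2) := by
    push_cast
    linear_combination u * hlam - u ^ 2 / 2 * hm
  have h1 : (w * (u - 1) ^ 2).re ≥ -(‖w‖ * ‖u - 1‖ ^ 2) := by
    have := Complex.abs_re_le_norm (w * (u - 1) ^ 2)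
    rw [norm_mul, norm_pow] at this
    exact (abs_le.1 this).1
  rw [e, Complex.re_ofReal_mul]
  have h2 : (1 + w / 2 + (u - 1) - w * (u - 1) ^ 2 / 2).re =
      1 + w.re / 2 + (u.re - 1) - (w * (u - 1) ^ 2).re / 2 := by
    have h2' : ∀ x : ℂ, (x / 2).re = x.re / 2 := fun x => by
      rw [show (2 : ℂ) = ((2 : ℝ) : ℂ) by simp, Complex.div_ofReal_re]
    simp only [Complex.sub_re, Complex.add_re, h2', Complex.one_re]
  have h3 : (1 + w / 2 + (u - 1) - w * (u - 1) ^ 2 / 2).re ≤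
      (1 + w.re / 2) + (ρ ^ 2 - 1) / 2 - (1 - ‖w‖) * ρ * (1 - Real.cos θ) := by
    have h4 : 2 * ρ * (1 - Real.cos θ) ≤ ‖u - 1‖ ^ 2 := by
      rw [hnu, hure]
      nlinarith [sq_nonneg (ρ - 1)]
    have h5 := mul_le_mul_of_nonneg_left h4 (sub_nonneg.2 hw)
    rw [h2]
    nlinarith
  have := mul_le_mul_of_nonneg_left h3 (Nat.cast_nonneg (α := ℝ) n)
  linarith

theorem hermite_term_le {n k : ℕ} (hk : 1 ≤ k) (hkn : k ≤ n) {t : ℝ} {z lam : ℂ} (hz : z ≠ 0)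
    (hlam : lam * (Real.sqrt n * z) = n * (1 + t * z ^ 2)) (hw : ‖t * z ^ 2‖ < 1) :
    (‖z‖ ^ 2) ^ n * ((n : ℝ) ^ n)⁻¹ * Real.exp (-(n * (t * z ^ 2 : ℂ).re)) *
      ((n ! : ℝ) / k ! * ‖(hermitePoly t k).eval lam‖ ^ 2) ≤
      Real.exp 1 ^ 2 / (1 - ‖t * z ^ 2‖) * (‖z‖ ^ 2) ^ (n - k) := by
  set w : ℂ := t * z ^ 2
  set p : ℝ := ‖(hermitePoly t k).eval lam‖
  have hn0 : (0 : ℝ) < n := by exact_mod_cast hk.trans hkn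
  have hk0 : (0 : ℝ) < k := by exact_mod_cast hk
  have hw0 : 0 < 1 - ‖w‖ := sub_pos.2 hw
  have hzn : 0 < ‖z‖ := norm_pos_iff.2 hz
  have hsn : Real.sqrt n ^ 2 = n := Real.sq_sqrt hn0.le
  have hsk : Real.sqrt k ^ 2 = k := Real.sq_sqrt hk0.le
  have hsn0 : 0 < Real.sqrt n := Real.sqrt_pos.2 hn0
  have hsk0 : 0 < Real.sqrt k := Real.sqrt_pos.2 hk0
  -- This radius minimises ρ^(-k) exp(nρ²/2), the radial part of the Cauchy bound.
  set ρ : ℝ := Real.sqrt k / Real.sqrt n with hρ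
  have hρ0 : 0 < ρ := by positivity
  have hρ2 : n * ρ ^ 2 = k := by
    rw [hρ, div_pow, hsn, hsk]; field_simp
  set c : ℝ := n * (1 - ‖w‖) * ρ with hc
  have hc0 : 0 < c := by positivity
  have hc' : c = (1 - ‖w‖) * (Real.sqrt n * Real.sqrt k) := by
    rw [hc, hρ]; nth_rewrite 1 [← hsn]; field_simp
  set J : ℝ := (2 * Real.pi)⁻¹ * ∫ θ in (0 : ℝ)..2 * Real.pi,
    Real.exp (-(c * (1 - Real.cos θ))) with hJ
  have hJ0 : 0 ≤ J := mul_nonneg (by positivity)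
    (intervalIntegral.integral_nonneg Real.two_pi_pos.le fun θ _ => (Real.exp_pos _).le)
  have hJc : J ^ 2 ≤ c⁻¹ := integral_exp_cos_le hc0
  set M : ℝ := Real.exp (n * (1 + w.re / 2) + n * (ρ ^ 2 - 1) / 2) with hM
  have hM2 : M ^ 2 = Real.exp n * Real.exp k * Real.exp (n * w.re) := by
    rw [hM, ← Real.exp_nat_mul, ← Real.exp_add, ← Real.exp_add]
    congr 1
    push_cast
    linear_combination hρ2
  have hsnC : (Real.sqrt n : ℂ) ^ 2 = n := by exact_mod_cast hsn
  have hgen : (2 * Real.pi)⁻¹ * ∫ θ in (0 : ℝ)..2 * Real.pi,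
      ‖hermiteGen t lam (Real.sqrt n * z) (circleMap 0 ρ θ)‖ ≤ M * J := by
    rw [hJ, mul_left_comm]
    refine mul_le_mul_of_nonneg_left ?_ (inv_nonneg.2 Real.two_pi_pos.le)
    rw [← intervalIntegral.integral_const_mul M]
    refine intervalIntegral.integral_mono_on Real.two_pi_pos.le
      (Continuous.intervalIntegrable ?_ _ _) (Continuous.intervalIntegrable (by fun_prop) _ _)
      fun θ _ => norm_hermiteGen_le (by rw [mul_pow, hsnC]; ring) hlam hw.le hρ0 θ
    simp only [hermiteGen]
    fun_prop
  have h1 := (norm_eval_hermitePoly_le t lam (Real.sqrt n * z) k hρ0).trans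
    (mul_le_mul_of_nonneg_left hgen (by positivity))
  have h2 : (k : ℝ) ^ k * (‖z‖ ^ 2) ^ k * p ^ 2 ≤
      (k ! : ℝ) ^ 2 * (Real.exp n * Real.exp k * Real.exp (n * w.re)) * c⁻¹ := by
    have h3 : ρ ^ k * (‖(Real.sqrt n * z : ℂ)‖ ^ k * p) ≤ k ! * (M * J) := by
      refine (mul_le_mul_of_nonneg_left h1 (by positivity)).trans_eq ?_
      field_simp
    have h4 := pow_le_pow_left₀ (by positivity) h3 2
    have h5 : (ρ ^ k * (‖(Real.sqrt n * z : ℂ)‖ ^ k * p)) ^ 2 =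
        (k : ℝ) ^ k * (‖z‖ ^ 2) ^ k * p ^ 2 := by
      rw [norm_mul, Complex.norm_real, Real.norm_of_nonneg hsn0.le]
      calc _ = (Real.sqrt n ^ 2 * ρ ^ 2) ^ k * (‖z‖ ^ 2) ^ k * p ^ 2 := by ring
        _ = _ := by rw [hsn, hρ2]
    rw [h5] at h4
    refine h4.trans ?_
    rw [mul_pow, mul_pow, hM2, ← mul_assoc]
    exact mul_le_mul_of_nonneg_left hJc (by positivity)
  have hfn := factorial_mul_exp_le (hk.trans hkn)
  have hfk := factorial_mul_exp_le hk
  have hE : Real.exp (-(n * w.re)) * Real.exp (n * w.re) = 1 := by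
    rw [← Real.exp_add]; simp
  have hkf : (0 : ℝ) < k ! := by positivity
  have hnf : (0 : ℝ) < n ! := by positivity
  have hZ : (‖z‖ ^ 2) ^ n = (‖z‖ ^ 2) ^ (n - k) * (‖z‖ ^ 2) ^ k := by
    rw [← pow_add, Nat.sub_add_cancel hkn]
  calc (‖z‖ ^ 2) ^ n * ((n : ℝ) ^ n)⁻¹ * Real.exp (-(n * w.re)) * ((n ! : ℝ) / k ! * p ^ 2)
      = (‖z‖ ^ 2) ^ (n - k) * ((n : ℝ) ^ n)⁻¹ * Real.exp (-(n * w.re)) * ((n ! : ℝ) / k !) *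
          ((k : ℝ) ^ k)⁻¹ * ((k : ℝ) ^ k * (‖z‖ ^ 2) ^ k * p ^ 2) := by
        rw [hZ]
        field_simp
    _ ≤ (‖z‖ ^ 2) ^ (n - k) * ((n : ℝ) ^ n)⁻¹ * Real.exp (-(n * w.re)) * ((n ! : ℝ) / k !) *
          ((k : ℝ) ^ k)⁻¹ *
          ((k ! : ℝ) ^ 2 * (Real.exp n * Real.exp k * Real.exp (n * w.re)) * c⁻¹) :=
        mul_le_mul_of_nonneg_left h2 (by positivity)
    -- The factor √n √k in c, gained from the angular integral, is exactly what the two Stirling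
    -- bounds lose.
    _ = (‖z‖ ^ 2) ^ (n - k) * (1 - ‖w‖)⁻¹ * ((n ! * Real.exp n) / (Real.sqrt n * (n : ℝ) ^ n)) *
          ((k ! * Real.exp k) / (Real.sqrt k * (k : ℝ) ^ k)) *
          (Real.exp (-(n * w.re)) * Real.exp (n * w.re)) := by
        rw [hc']
        field_simp
    _ ≤ (‖z‖ ^ 2) ^ (n - k) * (1 - ‖w‖)⁻¹ * Real.exp 1 * Real.exp 1 * 1 := by
        rw [hE]
        gcongr
        · rw [div_le_iff₀ (by positivity)]
          linarith
        · rw [div_le_iff₀ (by positivity)]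
          linarith
    _ = _ := by
        field_simp

/-- For k = 0 the radius √(k/n) degenerates. Here H_0 = 1, and Stirling leaves √n exp(-n(1 - |w|))
up to a constant, which exp(x) ≥ x controls. -/
theorem hermite_term_zero_le {n : ℕ} (hn : 1 ≤ n) {t : ℝ} {z lam : ℂ} (hz : ‖z‖ ≤ 1)
    (hw : ‖t * z ^ 2‖ < 1) :
    (‖z‖ ^ 2) ^ n * ((n : ℝ) ^ n)⁻¹ * Real.exp (-(n * (t * z ^ 2 : ℂ).re)) *
      ((n ! : ℝ) / 0 ! * ‖(hermitePoly t 0).eval lam‖ ^ 2) ≤ Real.exp 1 / (1 - ‖t * z ^ 2‖) := by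
  set w : ℂ := t * z ^ 2
  have hn0 : (0 : ℝ) < n := by exact_mod_cast hn
  have hw0 : 0 < 1 - ‖w‖ := sub_pos.2 hw
  have hfn := factorial_mul_exp_le hn
  have hsq : Real.sqrt n ≤ n := by
    rw [Real.sqrt_le_left hn0.le]
    have : (1 : ℝ) ≤ n := by exact_mod_cast hn
    nlinarith
  have hre : -w.re ≤ ‖w‖ := (neg_le_abs _).trans (Complex.abs_re_le_norm w)
  have hexp : n * (1 - ‖w‖) ≤ Real.exp (n * (1 - ‖w‖)) :=
    (by linarith : n * (1 - ‖w‖) ≤ n * (1 - ‖w‖) + 1).trans (Real.add_one_le_exp _)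
  have hZ : (‖z‖ ^ 2) ^ n ≤ 1 := pow_le_one₀ (by positivity) (pow_le_one₀ (norm_nonneg z) hz)
  have h1 : Real.exp (-(n * w.re)) ≤ Real.exp (n * ‖w‖) := by
    rw [Real.exp_le_exp, ← mul_neg]
    gcongr
  have hE : Real.exp n = Real.exp (n * ‖w‖) * Real.exp (n * (1 - ‖w‖)) := by
    rw [← Real.exp_add]; congr 1; ring
  have hp : 0 < Real.exp (n * ‖w‖) := Real.exp_pos _
  have hp' : 0 < Real.exp (n * (1 - ‖w‖)) := Real.exp_pos _
  simp only [hermitePoly, eval_one, norm_one, one_pow, mul_one, Nat.factorial_zero, Nat.cast_one,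
    div_one]
  calc (‖z‖ ^ 2) ^ n * ((n : ℝ) ^ n)⁻¹ * Real.exp (-(n * w.re)) * (n ! : ℝ)
      ≤ 1 * ((n : ℝ) ^ n)⁻¹ * Real.exp (n * ‖w‖) * (n ! : ℝ) := by gcongr
    _ = ((n : ℝ) ^ n)⁻¹ * (n ! * Real.exp n) / Real.exp (n * (1 - ‖w‖)) := by
        rw [hE]; field_simp
    _ ≤ ((n : ℝ) ^ n)⁻¹ * (Real.exp 1 * Real.sqrt n * (n : ℝ) ^ n) / (n * (1 - ‖w‖)) := by
        gcongr
    _ = Real.exp 1 * Real.sqrt n / (n * (1 - ‖w‖)) := by field_simp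
    _ ≤ Real.exp 1 * n / (n * (1 - ‖w‖)) := by gcongr
    _ = _ := by field_simp

theorem normCharFun_eq {n : ℕ} (hn : 1 ≤ n) (t : ℝ) (A : Matrix (Fin n) (Fin n) ℂ) {z : ℂ}
    (hz : z ≠ 0) : normCharFun t A z = (z / Real.sqrt n) ^ n *
      A.charpoly.eval (Real.sqrt n * (1 + t * z ^ 2) / z) *
        Complex.exp (-((n : ℂ) * t * z ^ 2 / 2)) := by
  have hs : (Real.sqrt n : ℂ) ≠ 0 := by
    have : (0 : ℝ) < n := by exact_mod_cast hn
    exact_mod_cast (Real.sqrt_pos.2 this).ne'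
  have h : (1 + (t : ℂ) * z ^ 2) • (1 : Matrix (Fin n) (Fin n) ℂ) - (z / (Real.sqrt n : ℂ)) • A =
      (z / (Real.sqrt n : ℂ)) •
        (Matrix.scalar (Fin n) (Real.sqrt n * (1 + t * z ^ 2) / z : ℂ) - A) := by
    rw [smul_sub, Matrix.scalar_apply, ← Matrix.smul_one_eq_diagonal, smul_smul]
    congr 2
    field_simp
  rw [normCharFun, h, Matrix.det_smul, Fintype.card_fin, Matrix.eval_charpoly]

theorem norm_normCharFun_sq {n : ℕ} (hn : 1 ≤ n) (t : ℝ) (A : Matrix (Fin n) (Fin n) ℂ) {z : ℂ}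
    (hz : z ≠ 0) : ‖normCharFun t A z‖ ^ 2 =
      (‖z‖ ^ 2) ^ n * ((n : ℝ) ^ n)⁻¹ * Real.exp (-(n * (t * z ^ 2 : ℂ).re)) *
        ‖leval (Real.sqrt n * (1 + t * z ^ 2) / z) A.charpoly‖ ^ 2 := by
  have h1 : ‖Complex.exp (-((n : ℂ) * t * z ^ 2 / 2))‖ ^ 2 =
      Real.exp (-(n * (t * z ^ 2 : ℂ).re)) := by
    have e : -((n : ℂ) * t * z ^ 2 / 2) = ((-(n : ℝ) / 2 : ℝ) : ℂ) * (t * z ^ 2) := by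
      push_cast; ring
    rw [Complex.norm_exp, ← Real.exp_nat_mul, e, Complex.re_ofReal_mul]
    congr 1
    push_cast
    ring
  have h2 : (Real.sqrt n ^ n) ^ 2 = (n : ℝ) ^ n := by
    rw [← pow_mul, mul_comm, pow_mul, Real.sq_sqrt (Nat.cast_nonneg n)]
  rw [normCharFun_eq hn t A hz, norm_mul, norm_mul, mul_pow, mul_pow, h1, norm_pow, norm_div,
    Complex.norm_real, Real.norm_of_nonneg (Real.sqrt_nonneg _), div_pow, div_pow, h2, leval_apply]
  ring

/-- The bound for the second moments at distance `r` from the origin. -/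
def momentBound (r : ℝ) : ℝ := (Real.exp 1 + Real.exp 1 ^ 2 * (1 - r ^ 2)⁻¹) / (1 - r ^ 2)

theorem integral_norm_normCharFun_sq_le {n : ℕ} (hn : 1 ≤ n) {t : ℝ} (ht : t ∈ Set.Icc (0 : ℝ) 1)
    {z : ℂ} (hz : z ≠ 0) (hz1 : ‖z‖ < 1) :
    Integrable (fun ω => ‖normCharFun t (modelMatrix n t ω) z‖ ^ 2) (pairLaw n) ∧
      ∫ ω, ‖normCharFun t (modelMatrix n t ω) z‖ ^ 2 ∂pairLaw n ≤ momentBound ‖z‖ := by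
  set lam : ℂ := Real.sqrt n * (1 + t * z ^ 2) / z with hlam
  have hn0 : (0 : ℝ) < n := by exact_mod_cast hn
  have hr : ‖z‖ ^ 2 < 1 := pow_lt_one₀ (norm_nonneg z) hz1 two_ne_zero
  have hwr : ‖(t : ℂ) * z ^ 2‖ ≤ ‖z‖ ^ 2 := by
    rw [norm_mul, norm_pow, Complex.norm_real, Real.norm_of_nonneg ht.1]
    exact mul_le_of_le_one_left (by positivity) ht.2
  have hw : ‖(t : ℂ) * z ^ 2‖ < 1 := hwr.trans_lt hr
  have hlam' : lam * (Real.sqrt n * z) = n * (1 + t * z ^ 2) := by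
    have hs : (Real.sqrt n : ℂ) ^ 2 = n := by exact_mod_cast Real.sq_sqrt hn0.le
    rw [hlam, ← hs]
    field_simp
  obtain ⟨⟨hmem, -⟩, hmom, -⟩ := IsElliptic.integral_norm_sq n (Fin n) (Fintype.card_fin n)
    (modelMatrix n t) (isElliptic_modelMatrix ht) (leval lam)
  simp only [norm_normCharFun_sq hn t _ hz]
  refine ⟨((memLp_two_iff_integrable_sq_norm hmem.1).1 hmem).const_mul _, ?_⟩
  rw [integral_const_mul, hmom, charpolyMoment, Finset.mul_sum, Finset.sum_range_succ']
  simp only [leval_apply]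
  have hgeo : ∑ k ∈ Finset.range n, (‖z‖ ^ 2) ^ (n - (k + 1)) ≤ (1 - ‖z‖ ^ 2)⁻¹ := by
    have h1 : ∑ k ∈ Finset.range n, (‖z‖ ^ 2) ^ (n - (k + 1)) =
        ∑ k ∈ Finset.range n, (‖z‖ ^ 2) ^ k := by
      rw [← Finset.sum_range_reflect]
      refine Finset.sum_congr rfl fun k hk => ?_
      have := Finset.mem_range.1 hk
      congr 1
      omega
    rw [h1, ← tsum_geometric_of_lt_one (by positivity) hr]
    exact (summable_geometric_of_lt_one (by positivity) hr).sum_le_tsum _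
      fun i _ => by positivity
  have h0 := hermite_term_zero_le hn (lam := lam) hz1.le hw
  have hk : ∀ k ∈ Finset.range n, (‖z‖ ^ 2) ^ n * ((n : ℝ) ^ n)⁻¹ *
      Real.exp (-(n * (t * z ^ 2 : ℂ).re)) *
      ((n ! : ℝ) / (k + 1) ! * ‖(hermitePoly t (k + 1)).eval lam‖ ^ 2) ≤
      Real.exp 1 ^ 2 / (1 - ‖t * z ^ 2‖) * (‖z‖ ^ 2) ^ (n - (k + 1)) := fun k hk =>
    hermite_term_le (by omega) (by simpa using hk) hz hlam' hw
  have hw0 : 0 < 1 - ‖(t : ℂ) * z ^ 2‖ := sub_pos.2 hw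
  have hr0 : 0 < 1 - ‖z‖ ^ 2 := sub_pos.2 hr
  refine (add_le_add (Finset.sum_le_sum hk) h0).trans ?_
  rw [← Finset.mul_sum, momentBound]
  calc Real.exp 1 ^ 2 / (1 - ‖(t : ℂ) * z ^ 2‖) * ∑ k ∈ Finset.range n, (‖z‖ ^ 2) ^ (n - (k + 1)) +
        Real.exp 1 / (1 - ‖(t : ℂ) * z ^ 2‖)
      ≤ Real.exp 1 ^ 2 / (1 - ‖z‖ ^ 2) * (1 - ‖z‖ ^ 2)⁻¹ + Real.exp 1 / (1 - ‖z‖ ^ 2) := by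
        gcongr
    _ = _ := by ring

end Bound

end EllipticGinibre

end

noncomputable section

namespace EllipticGinibre

open Filter Topology

/-! ### Montel's theorem in `HolD` -/

section Compactness

/-- Weierstrass: locally uniform limits of holomorphic functions are holomorphic. Functions on the
disk are extended by 0 to ℂ, which is harmless since the disk is open. -/
theorem isClosed_holomorphic : IsClosed {f : C(disk, ℂ) |
    ∃ g : ℂ → ℂ, DifferentiableOn ℂ g disk ∧ ∀ z : disk, f z = g z} := by
  classical
  refine isClosed_iff_forall_filter.2 fun f u hu hus huf => ?_
  let ext : C(disk, ℂ) → ℂ → ℂ := fun h z => if hz : z ∈ disk then h ⟨z, hz⟩ else 0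
  have hext : ∀ (h : C(disk, ℂ)) (z : disk), ext h z = h z := fun h z => by
    simp only [ext]
    rw [dif_pos z.2]
  have hloc : LocallyCompactSpace disk := Metric.isOpen_ball.locallyCompactSpace
  have h1 : TendstoLocallyUniformly (fun (h : C(disk, ℂ)) (z : disk) => h z) f u :=
    ContinuousMap.tendsto_iff_tendstoLocallyUniformly.1 (tendsto_id'.2 huf)
  have h2 : TendstoLocallyUniformlyOn ext (ext f) u disk := by
    rw [tendstoLocallyUniformlyOn_iff_tendstoLocallyUniformly_comp_coe]
    simp only [hext, Function.comp_def]
    exact h1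
  refine ⟨ext f, h2.differentiableOn ?_ Metric.isOpen_ball, fun z => (hext f z).symm⟩
  filter_upwards [le_principal_iff.1 hus] with h hh
  obtain ⟨g, hg, hgh⟩ := hh
  exact hg.congr fun z hz => by rw [← hgh ⟨z, hz⟩, ← hext h ⟨z, hz⟩]

theorem isInducing_val : IsInducing fun f : HolD => f.1 := IsInducing.subtypeVal

/-- The holomorphic functions on the disk which are bounded by `M m` on the disk of radius
`r m`. -/
def boundedFamily (r M : ℕ → ℝ) : Set HolD :=
  {f | ∀ m, ∀ z : disk, ‖(z : ℂ)‖ ≤ r m → ‖f.1 z‖ ≤ M m}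

/-- Arzelà–Ascoli: the bounds give pointwise relative compactness and, through the Schwarz lemma on
a small ball about each point, a common local Lipschitz estimate. -/
theorem isCompact_boundedFamily {r : ℕ → ℝ} (M : ℕ → ℝ) (hr : ∀ s < 1, ∃ m, s ≤ r m) :
    IsCompact (boundedFamily r M) := by
  rw [isInducing_val.isCompact_iff]
  set S : Set C(disk, ℂ) := (fun f : HolD => f.1) '' boundedFamily r M
  have hSeq : S = {f : C(disk, ℂ) | ∃ g : ℂ → ℂ, DifferentiableOn ℂ g disk ∧
      ∀ z : disk, f z = g z} ∩ {f | ∀ m, ∀ z : disk, ‖(z : ℂ)‖ ≤ r m → ‖f z‖ ≤ M m} := by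
    ext f
    constructor
    · rintro ⟨h, hh, rfl⟩
      exact ⟨h.2, hh⟩
    · rintro ⟨h1, h2⟩
      exact ⟨⟨f, h1⟩, h2, rfl⟩
  have hclosed : IsClosed S := by
    rw [hSeq]
    refine isClosed_holomorphic.inter ?_
    simp only [Set.ofPred_forall]
    refine isClosed_iInter fun m => isClosed_iInter fun z => isClosed_iInter fun _ => ?_
    exact isClosed_le (continuous_eval_const z).norm continuous_const
  have hloc : LocallyCompactSpace disk := Metric.isOpen_ball.locallyCompactSpace
  have hT2 : T2Space (UniformOnFun disk ℂ {K | IsCompact K}) :=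
    UniformOnFun.t2Space_of_covering
      (Set.eq_univ_of_forall fun z => ⟨{z}, isCompact_singleton, rfl⟩)
  rw [← hclosed.closure_eq]
  refine ArzelaAscoli.isCompact_closure_of_isClosedEmbedding (X := disk) (α := ℂ)
    (F := fun f : C(disk, ℂ) => (f : disk → ℂ))
    (𝔖 := {K | IsCompact K}) (fun K hK => hK)
    (ContinuousMap.isUniformEmbedding_toUniformOnFunIsCompact.isClosedEmbedding)
    (fun K _ => Equicontinuous.equicontinuousOn ?_ K) fun K _ z _ => ?_
  · intro z
    have hz : ‖(z : ℂ)‖ < 1 := mem_ball_zero_iff.1 z.2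
    -- Half the distance to the unit circle, so that one bound M m covers the whole ball of radius R
    -- about z.
    set R : ℝ := (1 - ‖(z : ℂ)‖) / 2 with hR
    have hR0 : 0 < R := by linarith
    obtain ⟨m, hm⟩ := hr (‖(z : ℂ)‖ + R) (by linarith)
    refine Metric.equicontinuousAt_of_continuity_modulus
      (fun x : disk => 2 * M m / R * dist (x : ℂ) z) ?_ _ ?_
    · have : Continuous fun x : disk => 2 * M m / R * dist (x : ℂ) z := by fun_prop
      simpa using this.tendsto z
    · have hnear : ∀ᶠ x : disk in 𝓝 z, (x : ℂ) ∈ Metric.ball (z : ℂ) R :=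
        continuous_subtype_val.continuousAt.eventually (Metric.ball_mem_nhds _ hR0)
      filter_upwards [hnear] with x hx f
      obtain ⟨⟨g, hg, hfg⟩, hb⟩ := hSeq.le f.2
      have hin : ∀ y ∈ Metric.ball (z : ℂ) R, ‖y‖ ≤ ‖(z : ℂ)‖ + R := fun y hy => by
        have h1 : ‖y - z‖ < R := by simpa [dist_eq_norm] using hy
        have h2 := norm_add_le (y - z) (z : ℂ)
        rw [sub_add_cancel] at h2
        linarith
      have hsub : Metric.ball (z : ℂ) R ⊆ disk := fun y hy => by
        have := hin y hy
        simp only [disk, Metric.mem_ball, dist_zero_right]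
        linarith
      have hgb : ∀ y ∈ Metric.ball (z : ℂ) R, ‖g y‖ ≤ M m := fun y hy => by
        rw [← hfg ⟨y, hsub hy⟩]
        exact hb m _ ((hin y hy).trans hm)
      have hmaps : Set.MapsTo g (Metric.ball (z : ℂ) R)
          (Metric.closedBall (g z) (2 * M m)) := fun y hy => by
        rw [Metric.mem_closedBall, dist_eq_norm]
        have h1 := norm_sub_le (g y) (g z)
        have h2 := hgb y hy
        have h3 := hgb z (Metric.mem_ball_self hR0)
        linarith
      have := Complex.dist_le_div_mul_dist_of_mapsTo_ball (hg.mono hsub) hmaps hx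
      rw [dist_comm]
      simpa only [Function.comp, hfg] using this
  · have hz : ‖(z : ℂ)‖ < 1 := mem_ball_zero_iff.1 z.2
    obtain ⟨m, hm⟩ := hr _ hz
    refine ⟨Metric.closedBall 0 (M m), isCompact_closedBall _ _, fun f hf => ?_⟩
    rw [hSeq] at hf
    simpa using hf.2 m z hm

end Compactness

/-! ### From circle integrals to pointwise bounds -/

section Cauchy

theorem norm_le_lintegral_circle {f : ℂ → ℂ} (hf : Differentiable ℂ f) {r R : ℝ} (hr : 0 ≤ r)
    (hrR : r < R) {z : ℂ} (hz : ‖z‖ ≤ r) {a : ℝ} (ha : 0 ≤ a)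
    (h : ∫⁻ θ in Set.Ioc 0 (2 * Real.pi), ‖f (circleMap 0 R θ)‖ₑ ≤ ENNReal.ofReal a) :
    ‖f z‖ ≤ R / (R - r) * a := by
  have hR : 0 < R := hr.trans_lt hrR
  have hc : Continuous fun θ => f (circleMap 0 R θ) := hf.continuous.comp (continuous_circleMap 0 R)
  have h1 := (hf.diffContOnCl (s := Metric.ball (0 : ℂ) R)
    ).two_pi_i_inv_smul_circleIntegral_sub_inv_smul (w := z) (by simpa using hz.trans_lt hrR)
  have h2 : ∫ θ in (0 : ℝ)..2 * Real.pi, ‖f (circleMap 0 R θ)‖ ≤ a := by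
    rw [intervalIntegral.integral_of_le Real.two_pi_pos.le,
      integral_eq_lintegral_of_nonneg_ae (ae_of_all _ fun θ => norm_nonneg _)
        hc.norm.aestronglyMeasurable]
    simp only [ofReal_norm]
    exact ENNReal.toReal_le_of_le_ofReal ha h
  have h3 : ‖∮ ζ in C(0, R), (ζ - z)⁻¹ • f ζ‖ ≤ R / (R - r) * a := by
    refine (intervalIntegral.norm_integral_le_integral_norm Real.two_pi_pos.le).trans ?_
    refine le_trans ?_ (mul_le_mul_of_nonneg_left h2
      (div_nonneg hR.le (sub_pos.2 hrR).le))
    rw [← intervalIntegral.integral_const_mul]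
    have hne : ∀ θ, circleMap 0 R θ - z ≠ 0 := fun θ h0 => by
      have : ‖circleMap 0 R θ‖ = ‖z‖ := by rw [sub_eq_zero.1 h0]
      rw [norm_circleMap_zero, abs_of_pos hR] at this
      linarith
    refine intervalIntegral.integral_mono_on Real.two_pi_pos.le
      (Continuous.intervalIntegrable ?_ _ _)
      ((continuous_const.mul hc.norm).intervalIntegrable _ _) fun θ _ => ?_
    · simp only [deriv_circleMap]
      exact (((continuous_circleMap 0 R).mul continuous_const).smul
        ((((continuous_circleMap 0 R).sub continuous_const).inv₀ hne).smul hc)).norm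
    · have h4 : R - r ≤ ‖circleMap 0 R θ - z‖ := by
        have := norm_sub_norm_le (circleMap 0 R θ) z
        rw [norm_circleMap_zero, abs_of_pos hR] at this
        linarith
      simp only [deriv_circleMap, norm_smul, norm_mul, norm_circleMap_zero, Complex.norm_I, mul_one,
        norm_inv, abs_of_pos hR]
      rw [← mul_assoc, div_eq_mul_inv]
      have := sub_pos.2 hrR
      gcongr
  rw [← h1, norm_smul]
  have h5 : ‖(2 * Real.pi * Complex.I : ℂ)⁻¹‖ ≤ 1 := by
    rw [norm_inv]
    refine inv_le_one_of_one_le₀ ?_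
    simp only [norm_mul, Complex.norm_I, Complex.norm_real, Complex.norm_ofNat, mul_one,
      Real.norm_of_nonneg Real.pi_pos.le]
    linarith [Real.two_le_pi]
  calc _ ≤ 1 * (R / (R - r) * a) := by gcongr
    _ = _ := one_mul _

end Cauchy

/-! ### Measurability, and reduction to the Gaussian model -/

section Law

instance (n : ℕ) : BorelSpace (Matrix (Fin n) (Fin n) ℂ) :=
  inferInstanceAs (BorelSpace (Fin n → Fin n → ℂ))

instance (n : ℕ) : SecondCountableTopology (Matrix (Fin n) (Fin n) ℂ) :=
  inferInstanceAs (SecondCountableTopology (Fin n → Fin n → ℂ))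

theorem continuous_normCharFun (n : ℕ) (t : ℝ) :
    Continuous fun p : Matrix (Fin n) (Fin n) ℂ × ℂ => normCharFun t p.1 p.2 := by
  unfold normCharFun
  have h : Continuous fun p : Matrix (Fin n) (Fin n) ℂ × ℂ =>
      (1 + (t : ℂ) * p.2 ^ 2) • (1 : Matrix (Fin n) (Fin n) ℂ) -
        (p.2 / (Real.sqrt n : ℂ)) • p.1 := by fun_prop
  exact h.matrix_det.mul (by fun_prop)

theorem continuous_normCharPoly (n : ℕ) (t : ℝ) :
    Continuous (normCharPoly t : Matrix (Fin n) (Fin n) ℂ → HolD) := by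
  rw [isInducing_val.continuous_iff]
  have hg : Continuous fun p : Matrix (Fin n) (Fin n) ℂ × disk => (p.1, (p.2 : ℂ)) := by fun_prop
  have h : Continuous fun p : Matrix (Fin n) (Fin n) ℂ × disk => normCharFun t p.1 (p.2 : ℂ) := by
    have := (continuous_normCharFun n t).comp hg
    rwa [Function.comp_def] at this
  refine ContinuousMap.continuous_of_continuous_uncurry
    (fun A : Matrix (Fin n) (Fin n) ℂ => (normCharPoly t A).1) ?_
  exact h

theorem measurable_ellipticMatrix (n : ℕ) (t : ℝ) :
    Measurable fun p : Matrix (Fin n) (Fin n) ℂ × Matrix (Fin n) (Fin n) ℂ =>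
      ellipticMatrix t p.1 p.2 := by
  have : Continuous fun p : Matrix (Fin n) (Fin n) ℂ × Matrix (Fin n) (Fin n) ℂ =>
      ellipticMatrix t p.1 p.2 := by
    unfold ellipticMatrix
    fun_prop
  exact this.measurable

theorem map_pairLaw (n : ℕ) :
    (pairLaw n).map (fun ω => (hermitianOf fun p => (ω p).1, hermitianOf fun p => (ω p).2)) =
      (gue n).prod (gue n) := by
  have hmp := measurePreserving_arrowProdEquivProdArrow ℝ ℝ (Fin n × Fin n)
    (fun _ => gaussianReal 0 1) (fun _ => gaussianReal 0 1)
  have h := hmp.map_eq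
  rw [gue, Measure.map_prod_map _ _ (measurable_hermitianOf n) (measurable_hermitianOf n), ← h,
    Measure.map_map ((measurable_hermitianOf n).prodMap (measurable_hermitianOf n))
      hmp.measurable]
  rfl

theorem measurable_modelMatrix (n : ℕ) (t : ℝ) : Measurable (modelMatrix n t) := by
  have h1 : Measurable fun ω : Fin n × Fin n → ℝ × ℝ =>
      (hermitianOf fun p => (ω p).1, hermitianOf fun p => (ω p).2) :=
    ((measurable_hermitianOf n).comp (by fun_prop)).prodMk
      ((measurable_hermitianOf n).comp (by fun_prop))
  exact (measurable_ellipticMatrix n t).comp h1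

/-- Tightness concerns laws only, so any independent GUE pair may be exchanged for the explicit
Gaussian coordinates. -/
theorem map_ellipticMatrix_eq {Ω : Type*} [MeasurableSpace Ω] {P : Measure Ω}
    [IsProbabilityMeasure P] {n : ℕ} {X Y : Ω → Matrix (Fin n) (Fin n) ℂ}
    (hX : HasLaw X (gue n) P) (hY : HasLaw Y (gue n) P) (hXY : IndepFun X Y P) (t : ℝ) :
    P.map (fun ω => ellipticMatrix t (X ω) (Y ω)) = (pairLaw n).map (modelMatrix n t) := by
  have h1 : P.map (fun ω => (X ω, Y ω)) = (gue n).prod (gue n) := by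
    rw [(indepFun_iff_map_prod_eq_prod_map_map hX.aemeasurable hY.aemeasurable).1 hXY, hX.map_eq,
      hY.map_eq]
  have h2 := congrArg (Measure.map fun p : Matrix (Fin n) (Fin n) ℂ × Matrix (Fin n) (Fin n) ℂ =>
      ellipticMatrix t p.1 p.2) (h1.trans (map_pairLaw n).symm)
  have h3 : Measurable fun ω : Fin n × Fin n → ℝ × ℝ =>
      (hermitianOf fun p => (ω p).1, hermitianOf fun p => (ω p).2) :=
    ((measurable_hermitianOf n).comp (by fun_prop)).prodMk
      ((measurable_hermitianOf n).comp (by fun_prop))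
  rw [AEMeasurable.map_map_of_aemeasurable (measurable_ellipticMatrix n t).aemeasurable
    (hX.aemeasurable.prodMk hY.aemeasurable),
    Measure.map_map (measurable_ellipticMatrix n t) h3] at h2
  exact h2

end Law

/-! ### Markov's inequality along an exhaustion of the disk -/

section Tightness

theorem lintegral_circle_normCharFun_le {n : ℕ} (hn : 1 ≤ n) {t : ℝ}
    (ht : t ∈ Set.Icc (0 : ℝ) 1) {R : ℝ} (hR : 0 < R) (hR1 : R < 1) :
    ∫⁻ ω, ∫⁻ θ in Set.Ioc 0 (2 * Real.pi),
      ‖normCharFun t (modelMatrix n t ω) (circleMap 0 R θ)‖ₑ ∂volume ∂pairLaw n ≤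
      ENNReal.ofReal (2 * Real.pi * (1 + momentBound R)) := by
  have hm : Measurable fun p : (Fin n × Fin n → ℝ × ℝ) × ℝ =>
      ‖normCharFun t (modelMatrix n t p.1) (circleMap 0 R p.2)‖ₑ :=
    ((continuous_normCharFun n t).measurable.comp
      (((measurable_modelMatrix n t).comp measurable_fst).prodMk
        ((continuous_circleMap 0 R).measurable.comp measurable_snd))).enorm
  rw [lintegral_lintegral_swap hm.aemeasurable]
  have hθ : ∀ θ, ∫⁻ ω, ‖normCharFun t (modelMatrix n t ω) (circleMap 0 R θ)‖ₑ ∂pairLaw n ≤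
      ENNReal.ofReal (1 + momentBound R) := by
    intro θ
    have hnorm : ‖circleMap 0 R θ‖ = R := by rw [norm_circleMap_zero, abs_of_pos hR]
    obtain ⟨hi, hle⟩ := integral_norm_normCharFun_sq_le hn ht (z := circleMap 0 R θ)
      (norm_pos_iff.1 (by rwa [hnorm])) (by rwa [hnorm])
    rw [hnorm] at hle
    have hi' : Integrable (fun ω => 1 + ‖normCharFun t (modelMatrix n t ω) (circleMap 0 R θ)‖ ^ 2)
      (pairLaw n) := (integrable_const _).add hi
    -- The second moment bounds the first through x ≤ 1 + x².
    calc ∫⁻ ω, ‖normCharFun t (modelMatrix n t ω) (circleMap 0 R θ)‖ₑ ∂pairLaw n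
        ≤ ∫⁻ ω, ENNReal.ofReal
            (1 + ‖normCharFun t (modelMatrix n t ω) (circleMap 0 R θ)‖ ^ 2) ∂pairLaw n := by
          refine lintegral_mono fun ω => ?_
          rw [← ofReal_norm]
          refine ENNReal.ofReal_le_ofReal ?_
          nlinarith [sq_nonneg (‖normCharFun t (modelMatrix n t ω) (circleMap 0 R θ)‖ - 1),
            norm_nonneg (normCharFun t (modelMatrix n t ω) (circleMap 0 R θ))]
      _ = ENNReal.ofReal (∫ ω,
            (1 + ‖normCharFun t (modelMatrix n t ω) (circleMap 0 R θ)‖ ^ 2) ∂pairLaw n) :=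
          (ofReal_integral_eq_lintegral_ofReal hi' (ae_of_all _ fun ω => by positivity)).symm
      _ ≤ ENNReal.ofReal (1 + momentBound R) := by
          refine ENNReal.ofReal_le_ofReal ?_
          rw [integral_add (integrable_const _) hi]
          simpa using hle
  refine (lintegral_mono fun θ => hθ θ).trans ?_
  rw [lintegral_const, Measure.restrict_apply MeasurableSet.univ, Set.univ_inter, Real.volume_Ioc,
    sub_zero, mul_comm, ← ENNReal.ofReal_mul Real.two_pi_pos.le]

/-- An increasing sequence of radii which exhausts the unit disk. -/
def radius (m : ℕ) : ℝ := 1 - 1 / (m + 2)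

theorem isTightMeasureSet_normCharPoly {t : ℝ} (ht : t ∈ Set.Icc (0 : ℝ) 1) :
    IsTightMeasureSet {μ : Measure HolD | ∃ n : ℕ, 1 ≤ n ∧
      μ = (pairLaw n).map fun ω => normCharPoly t (modelMatrix n t ω)} := by
  rw [isTightMeasureSet_iff_exists_isCompact_measure_compl_le]
  intro ε hε
  obtain ⟨δ, hδ, hsum⟩ := ENNReal.exists_pos_sum_of_countable hε.ne' ℕ
  have hr0 : ∀ m, 0 < radius m := fun m => by
    have : (1 : ℝ) / (m + 2) ≤ 1 / 2 := by gcongr; linarith [Nat.cast_nonneg (α := ℝ) m]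
    rw [radius]
    linarith
  have hr1 : ∀ m, radius m < 1 := fun m => by
    have : (0 : ℝ) < 1 / (m + 2) := by positivity
    rw [radius]
    linarith
  set R : ℕ → ℝ := fun m => (1 + radius m) / 2 with hRdef
  have hR0 : ∀ m, 0 < R m := fun m => by have := hr0 m; simp only [hRdef]; linarith
  have hR1 : ∀ m, R m < 1 := fun m => by have := hr1 m; simp only [hRdef]; linarith
  have hrR : ∀ m, radius m < R m := fun m => by have := hr1 m; simp only [hRdef]; linarith
  set B : ℕ → ℝ := fun m => 2 * Real.pi * (1 + momentBound (R m)) with hBdef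
  have hB0 : ∀ m, 0 < B m := fun m => by
    have h1 : 0 < 1 - R m ^ 2 := sub_pos.2 (pow_lt_one₀ (hR0 m).le (hR1 m) two_ne_zero)
    have := Real.pi_pos
    simp only [hBdef, momentBound]
    positivity
  -- Markov's inequality at this level costs probability at most δ m, and the δ m sum to less than
  -- ε. Neither B nor δ depends on n, so one compact set serves all n.
  set a : ℕ → ℝ := fun m => B m / δ m with hadef
  have ha0 : ∀ m, 0 < a m := fun m => div_pos (hB0 m) (hδ m)
  set M : ℕ → ℝ := fun m => R m / (R m - radius m) * a m
  have hK : IsCompact (boundedFamily radius M) := by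
    refine isCompact_boundedFamily M fun s hs => ?_
    obtain ⟨m, hm⟩ := exists_nat_one_div_lt (sub_pos.2 hs)
    refine ⟨m, ?_⟩
    have : (1 : ℝ) / (m + 2) ≤ 1 / (m + 1) := by gcongr; linarith
    rw [radius]
    linarith
  have hT2 : T2Space HolD := inferInstanceAs (T2Space
    {f : C(disk, ℂ) // ∃ g : ℂ → ℂ, DifferentiableOn ℂ g disk ∧ ∀ z : disk, f z = g z})
  refine ⟨boundedFamily radius M, hK, ?_⟩
  rintro μ ⟨n, hn, rfl⟩
  have hmeas : Measurable fun ω => normCharPoly t (modelMatrix n t ω) :=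
    (continuous_normCharPoly n t).measurable.comp (measurable_modelMatrix n t)
  rw [Measure.map_apply hmeas hK.isClosed.measurableSet.compl]
  set N : ℕ → (Fin n × Fin n → ℝ × ℝ) → ENNReal := fun m ω =>
    ∫⁻ θ in Set.Ioc 0 (2 * Real.pi),
      ‖normCharFun t (modelMatrix n t ω) (circleMap 0 (R m) θ)‖ₑ with hN
  have hNm : ∀ m, Measurable (N m) := fun m => by
    have hm : Measurable fun p : (Fin n × Fin n → ℝ × ℝ) × ℝ =>
        ‖normCharFun t (modelMatrix n t p.1) (circleMap 0 (R m) p.2)‖ₑ :=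
      ((continuous_normCharFun n t).measurable.comp
        (((measurable_modelMatrix n t).comp measurable_fst).prodMk
          ((continuous_circleMap 0 (R m)).measurable.comp measurable_snd))).enorm
    exact hm.lintegral_prod_right'
  have hsub : (fun ω => normCharPoly t (modelMatrix n t ω)) ⁻¹' (boundedFamily radius M)ᶜ ⊆
      ⋃ m, {ω | ENNReal.ofReal (a m) ≤ N m ω} := by
    intro ω hω
    by_contra hcon
    simp only [Set.mem_iUnion, not_exists, Set.mem_ofPred_eq, not_le] at hcon
    refine hω fun m z hz => ?_
    exact norm_le_lintegral_circle (differentiable_normCharFun t (modelMatrix n t ω)) (hr0 m).le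
      (hrR m) hz (ha0 m).le (hcon m).le
  refine (measure_mono hsub).trans ((measure_iUnion_le _).trans (le_trans ?_ hsum.le))
  refine ENNReal.tsum_le_tsum fun m => ?_
  have hmark := meas_ge_le_lintegral_div (μ := pairLaw n) (hNm m).aemeasurable
    (ε := ENNReal.ofReal (a m)) (by simpa using ha0 m) ENNReal.ofReal_ne_top
  refine hmark.trans ((ENNReal.div_le_div_right
    (lintegral_circle_normCharFun_le hn ht (hR0 m) (hR1 m)) _).trans ?_)
  rw [← ENNReal.ofReal_div_of_pos (ha0 m)]
  have hB := hB0 m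
  have hδm : (0 : ℝ) < δ m := hδ m
  have : 2 * Real.pi * (1 + momentBound (R m)) / a m = δ m := by
    change B m / (B m / δ m) = δ m
    field_simp
  rw [this, ENNReal.ofReal_coe_nnreal]

end Tightness

end EllipticGinibre

end

theorem theorem2 (t : ℝ) (ht : t ∈ Set.Icc (0 : ℝ) 1)
    {Ω : ℕ → Type*} [∀ n, MeasurableSpace (Ω n)]
    (P : ∀ n, Measure (Ω n)) [∀ n, IsProbabilityMeasure (P n)]
    (X Y : ∀ n, Ω n → Matrix (Fin n) (Fin n) ℂ)
    (hX : ∀ n, 1 ≤ n → HasLaw (X n) (EllipticGinibre.gue n) (P n))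
    (hY : ∀ n, 1 ≤ n → HasLaw (Y n) (EllipticGinibre.gue n) (P n))
    (hXY : ∀ n, 1 ≤ n → IndepFun (X n) (Y n) (P n))
    (f : ∀ n, Ω n → EllipticGinibre.HolD)
    (hf : ∀ n, 1 ≤ n → ∀ ω, f n ω =
      EllipticGinibre.normCharPoly t (EllipticGinibre.ellipticMatrix t (X n ω) (Y n ω))) :
    (∀ n, 1 ≤ n → AEMeasurable (f n) (P n)) ∧
      IsTightMeasureSet {μ : Measure EllipticGinibre.HolD |
        ∃ n : ℕ, 1 ≤ n ∧ μ = (P n).map (f n)} := by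
  have hfun : ∀ n, 1 ≤ n → f n = fun ω =>
      EllipticGinibre.normCharPoly t (EllipticGinibre.ellipticMatrix t (X n ω) (Y n ω)) :=
    fun n hn => funext (hf n hn)
  have hA : ∀ n, 1 ≤ n → AEMeasurable
      (fun ω => EllipticGinibre.ellipticMatrix t (X n ω) (Y n ω)) (P n) := fun n hn =>
    (EllipticGinibre.measurable_ellipticMatrix n t).comp_aemeasurable
      ((hX n hn).aemeasurable.prodMk (hY n hn).aemeasurable)
  have hQ := fun n => (EllipticGinibre.continuous_normCharPoly n t).measurable
  refine ⟨fun n hn => ?_, (EllipticGinibre.isTightMeasureSet_normCharPoly ht).subset ?_⟩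
  · rw [hfun n hn]
    exact (hQ n).comp_aemeasurable (hA n hn)
  · rintro μ ⟨n, hn, rfl⟩
    refine ⟨n, hn, ?_⟩
    have h := congrArg (Measure.map (EllipticGinibre.normCharPoly t))
      (EllipticGinibre.map_ellipticMatrix_eq (hX n hn) (hY n hn) (hXY n hn) t)
    rw [AEMeasurable.map_map_of_aemeasurable (hQ n).aemeasurable (hA n hn),
      Measure.map_map (hQ n) (EllipticGinibre.measurable_modelMatrix n t)] at h
    rw [hfun n hn]
    exact h
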